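/- Let $\mathcal L=\{\in,F\}$ with $F$ a unary function symbol, and let $\mathrm{ZFGC}$ be $\mathrm{ZF}$, with separation and replacement for all $\mathcal L$-formulas, together with the global choice axiom $\forall x\,(x\neq\emptyset\rightarrow F(x)\in x)$. For $M\models\mathrm{ZFGC}$ let $\omega^M$ be the set of those elements of $M$ that $M$ believes to be natural numbers, ordered by $\alpha<\beta\iff M\models\alpha\in\beta$. Let $\mathcal L_M$ be $\mathcal L$ with constants for the elements of $M$; an elementary extension of $M$ is regarded as an $\mathcal L_M$-structure. A type $p(v)$ over $M$ is a set of $\mathcal L_M$-formulas in the variable $v$ that is finitely satisfiable in $M$. It is *$\omega$-minimal* if - $(v<\omega)\in p(v)$; - $(\alpha<v)\in p(v)$ for all $\alpha\in\omega^M$; and - whenever $M\prec N$ and $\alpha_0<\dots<\alpha_n$ and $\beta_0<\dots<\beta_n$ are two increasing sequences of realizations of $p$ in $N$, then $(N,\bar\alpha)\equiv(N,\bar\beta)$ as expansions of $\mathcal L_M$-structures, that is, $\bar\alpha$ and $\bar\beta$ satisfy the same $\mathcal L_M$-formulas in $N$. An elementary extension $N$ of $M$ is an *$\omega$-end extension*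 if $\alpha<\beta$ for all $\alpha\in\omega^M$ and $\beta\in\omega^N\setminus\omega^M$. It is *generated over $M$* by $X\subseteq N$ if $N$ is the Skolem hull of $M\cup X$. Skolem functions are the definable functions, and those of $\mathcal L_M$ are the functions on $N$ that are $\mathcal L$-definable with parameters from $M$. For $M\prec N$ and $\beta\in\omega^N$ let $$N_\omega(\beta)=\{\alpha\in\omega^N:\ \text{for some unary Skolem function } t \text{ of } \mathcal L_M,\ t(\beta)\in\omega^N \text{ and } \alpha<t(\beta)\},$$ $$N_\omega[\beta]=\{\alpha\in\omega^N:\ \text{for every unary Skolem function } t \text{ of } \mathcal L_M,\ \text{if } t(\alpha)\in\omega^N \text{ then } t(\alpha)<\beta\},$$ and let $\mathrm{gap}_\omega(\beta)=N_\omega(\beta)\setminus N_\omega[\beta]$ be the $\omega$-gap of $\beta$ in $N$ (over $M$). **Theorem.** Let $M\models\mathrm{ZFGC}$, let $p(v)$ be an $\omega$-minimal type over $M$, and let $(I,<)$ be a linearly ordered set. Then there are an elementary $\omega$-end extension $N\succ M$ and realizations $\alpha_i\in\omega^N$ ($i\in I$) of $p$, with $\alpha_i<\alpha_j$ whenever $i<j$,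 such that $N$ is generated over $M$ by $\{\alpha_i: i\in I\}$ and $$\omega^N=\omega^M\cup\bigcup_{i\in I}\mathrm{gap}_\omega(\alpha_i).$$ -/

import Mathlib

universe u v

open scoped FirstOrder

namespace GaifmanSet

/-- The function symbols of the language of set theory with global choice: one unary symbol. -/
inductive SetFunc : ℕ → Type
  | choice : SetFunc 1

/-- The relation symbols: membership. -/
inductive SetRel : ℕ → Type
  | mem : SetRel 2

/-- The first-order language `{∈, F}`, where `F` is a unary function symbol (global choice). -/
def setLang : FirstOrder.Language.{0, 0} := ⟨SetFunc, SetRel⟩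

/-- The relation symbol `∈`. -/
abbrev memSym : setLang.Relations 2 := SetRel.mem

/-- The function symbol `F`. -/
abbrev choiceSym : setLang.Functions 1 := SetFunc.choice

/-- Membership in the sense of a `{∈, F}`-structure. -/
def Mem {M : Type u} [setLang.Structure M] (x y : M) : Prop :=
  FirstOrder.Language.Structure.RelMap memSym ![x, y]

/-- The value `F x` in a `{∈, F}`-structure. -/
def choiceFun {M : Type u} [setLang.Structure M] (x : M) : M :=
  FirstOrder.Language.Structure.funMap choiceSym ![x]

infix:50 " ∈ₘ " => Mem

section Structure

variable {M : Type u} [setLang.Structure M]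

/-- `y = x ∪ {x}` in the sense of the structure. -/
def IsSuccOf (y x : M) : Prop := ∀ z : M, z ∈ₘ y ↔ z ∈ₘ x ∨ z = x

/-- `w` contains the empty set and is closed under `x ↦ x ∪ {x}`, in the sense of the structure. -/
def IsInductive (w : M) : Prop :=
  (∃ e : M, (∀ z : M, ¬ z ∈ₘ e) ∧ e ∈ₘ w) ∧
    ∀ x : M, x ∈ₘ w → ∃ y : M, IsSuccOf y x ∧ y ∈ₘ w

/-- `w` is the set `ω` of the structure: the least inductive set. -/
def IsOmega (w : M) : Prop :=
  IsInductive w ∧ ∀ w' : M, IsInductive w' → ∀ x : M, x ∈ₘ w → x ∈ₘ w'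

variable (M) in
/-- `ω^M`: the set of all elements of `M` which `M` believes to be natural numbers.
The ordering of natural numbers is `∈ₘ`. -/
def omegaSet : Set M := {x | ∃ w : M, IsOmega w ∧ x ∈ₘ w}

variable (M) in
/-- `M` is a model of `ZFGC`, that is, `ZF` with the schemes of separation and replacement for all
formulas of the language `{∈, F}` (with parameters), plus `F x ∈ x` for every nonempty `x`. -/
structure IsModelZFGC : Prop where
  extensionality : ∀ x y : M, (∀ z : M, z ∈ₘ x ↔ z ∈ₘ y) → x = y
  foundation : ∀ x : M, (∃ y : M, y ∈ₘ x) → ∃ y : M, y ∈ₘ x ∧ ∀ z : M, ¬ (z ∈ₘ y ∧ z ∈ₘ x)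
  pairing : ∀ x y : M, ∃ z : M, ∀ t : M, t ∈ₘ z ↔ t = x ∨ t = y
  union : ∀ x : M, ∃ z : M, ∀ t : M, t ∈ₘ z ↔ ∃ y : M, y ∈ₘ x ∧ t ∈ₘ y
  power : ∀ x : M, ∃ z : M, ∀ t : M, t ∈ₘ z ↔ ∀ s : M, s ∈ₘ t → s ∈ₘ x
  infinity : ∃ w : M, IsInductive w
  separation : ∀ D : Set M, (Set.univ : Set M).Definable₁ setLang D →
    ∀ x : M, ∃ z : M, ∀ t : M, t ∈ₘ z ↔ t ∈ₘ x ∧ t ∈ D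
  replacement : ∀ R : M → M → Prop, (Set.univ : Set M).Definable₂ setLang {q : M × M | R q.1 q.2} →
    ∀ x : M, (∀ s : M, s ∈ₘ x → ∃! t : M, R s t) →
      ∃ z : M, ∀ t : M, t ∈ₘ z ↔ ∃ s : M, s ∈ₘ x ∧ R s t
  globalChoice : ∀ x : M, (∃ y : M, y ∈ₘ x) → choiceFun x ∈ₘ x

/-- `t` is an `n`-ary Skolem function with parameters from `A`. As `ZFGC` has built-in Skolem
functions, these are the functions which are first-order definable with parameters from `A`. -/
def IsSkolemFunction (A : Set M) {n : ℕ} (t : (Fin n → M) → M) : Prop :=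
  A.Definable setLang {x : Fin (n + 1) → M | x 0 = t (Fin.tail x)}

/-- The Skolem hull of `A`: all values of parameter-free Skolem functions at tuples from `A`. -/
def skolemHull (A : Set M) : Set M :=
  {b | ∃ (n : ℕ) (t : (Fin n → M) → M) (c : Fin n → M),
    IsSkolemFunction ∅ t ∧ (∀ i, c i ∈ A) ∧ t c = b}

/-- `M_ω(β)`, with Skolem functions taking parameters from `A`. -/
def gapUpper (A : Set M) (β : M) : Set M :=
  {γ | γ ∈ omegaSet M ∧ ∃ t : (Fin 1 → M) → M, IsSkolemFunction A t ∧
    t ![β] ∈ omegaSet M ∧ γ ∈ₘ t ![β]}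

/-- `M_ω[β]`, with Skolem functions taking parameters from `A`. -/
def gapLower (A : Set M) (β : M) : Set M :=
  {γ | γ ∈ omegaSet M ∧ ∀ t : (Fin 1 → M) → M, IsSkolemFunction A t →
    t ![γ] ∈ omegaSet M → t ![γ] ∈ₘ β}

/-- The `ω`-gap of `β`, with Skolem functions taking parameters from `A`. -/
def omegaGap (A : Set M) (β : M) : Set M := gapUpper A β \ gapLower A β

end Structure

section Types

variable {M : Type u} [setLang.Structure M]

variable (M) in
/-- Formulas `φ(v₀, …, vₙ₋₁)` with parameters from `M`; the variable `Sum.inl m` stands for the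
parameter `m`. -/
abbrev ParamFormula (n : ℕ) : Type u := setLang.Formula (M ⊕ Fin n)

/-- `N ⊨ φ(a₀, …, aₙ₋₁)`, the parameters being interpreted along `f : M → N`. -/
def Holds {N : Type v} [setLang.Structure N] (f : M → N) {n : ℕ} (φ : ParamFormula M n)
    (a : Fin n → N) : Prop :=
  φ.Realize (Sum.elim f a)

/-- The formula `v ∈ m` with parameter `m`. -/
def varMemParam (m : M) : ParamFormula M 1 :=
  memSym.formula₂ (FirstOrder.Language.Term.var (Sum.inr 0)) (FirstOrder.Language.Term.var (Sum.inl m))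

/-- The formula `m ∈ v` with parameter `m`. -/
def paramMemVar (m : M) : ParamFormula M 1 :=
  memSym.formula₂ (FirstOrder.Language.Term.var (Sum.inl m)) (FirstOrder.Language.Term.var (Sum.inr 0))

/-- `p(v)` is a type over `M`: a set of formulas with parameters from `M` which is finitely
satisfiable in `M`. -/
def IsTypeOver (p : Set (ParamFormula M 1)) : Prop :=
  ∀ s : Finset (ParamFormula M 1), (s : Set (ParamFormula M 1)) ⊆ p →
    ∃ a : M, ∀ φ ∈ s, Holds id φ ![a]

/-- `a : N` realizes `p(v)`, where `M` is embedded in `N` by `f`. -/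
def Realizes {N : Type v} [setLang.Structure N] (f : M → N) (p : Set (ParamFormula M 1)) (a : N) :
    Prop :=
  ∀ φ ∈ p, Holds f φ ![a]

/-- `p(v)` is an `ω`-type: the formula `v < ω` belongs to `p(v)`. -/
def IsOmegaType (p : Set (ParamFormula M 1)) : Prop :=
  IsTypeOver p ∧ ∃ w : M, IsOmega w ∧ varMemParam w ∈ p

/-- `ω`-unboundedness: `m < v` belongs to `p(v)` for every `m ∈ ω^M`. -/
def IsOmegaUnbounded (p : Set (ParamFormula M 1)) : Prop :=
  ∀ m ∈ omegaSet M, paramMemVar m ∈ p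

/-- Indiscernibility: in every elementary extension `N` of `M`, any two increasing sequences of
realizations of `p` of the same finite length satisfy the same formulas with parameters from `M`.
(By the downward Löwenheim–Skolem theorem only extensions of the size of `M` matter.) -/
def IsIndiscernibleType (p : Set (ParamFormula M 1)) : Prop :=
  ∀ (N : Type u) [setLang.Structure N] (f : M ↪ₑ[setLang] N) (n : ℕ) (a b : Fin n → N),
    (∀ i, Realizes f p (a i)) → (∀ i j, i < j → a i ∈ₘ a j) →
    (∀ i, Realizes f p (b i)) → (∀ i j, i < j → b i ∈ₘ b j) →
    ∀ φ : ParamFormula M n, Holds f φ a ↔ Holds f φ b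

/-- `p(v)` is an `ω`-minimal type over `M`. -/
structure IsOmegaMinimal (p : Set (ParamFormula M 1)) : Prop where
  omegaType : IsOmegaType p
  unbounded : IsOmegaUnbounded p
  indiscernible : IsIndiscernibleType p

/-- The extension `f : M → N` is an `ω`-end extension: every new natural number of `N` lies above
all natural numbers of `M`. -/
def IsOmegaEndExtension {N : Type v} [setLang.Structure N] (f : M → N) : Prop :=
  ∀ a ∈ omegaSet M, ∀ b ∈ omegaSet N, b ∉ f '' omegaSet M → f a ∈ₘ b

end Types

end GaifmanSet

-- Compactness gives an elementary extension of `M` with an increasing family `α i` of realizations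
-- of `p` (`exists_extension_realizing`), and `N` is the definable closure of `M` and this family
-- inside it. The closure is an elementary substructure because ZFGC has definable choice: a
-- nonempty definable class meets a least level of the cumulative hierarchy, and it does so in a
-- set, to which `F` applies (`exists_definable_mem`).
--
-- It remains to locate a new natural number `b` of `N` (`new_number`). Write `b` as the value of an
-- `M`-definable partial function at an increasing tuple of the `α i` of least possible length. By
-- indiscernibility and compactness, each definable property of increasing tuples is decided by
-- finitely many formulas of `p` (`exists_homogeneous`). Apply this to the property that the values
-- at `(x, u)` and `(x, v)` agree, where `x < u < v`. If they always agree, the last argument is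
-- superfluous, against minimality. So they never agree, and homogeneity for every way of
-- interleaving two tuples shows that the value determines the last argument
-- (`reduce_or_determine`).
--
-- Let `a` be the last `α i` in the tuple. Then `a` is a Skolem function of `b`, so `b` is not in
-- the lower part of the gap of `a`. On the other hand `b` lies below the least bound for the values
-- at tuples of numbers up to `a`, which is a Skolem function of `a`. Hence `b` is in the gap of
-- `a`. If `b` were below a number of `M`, then `a` would be below a bound definable over `M`, hence
-- below a number of `M`, although `p` is unbounded (`not_mem_map_of_determined`). This is the end
-- extension property.

universe w

namespace GaifmanSet

open FirstOrder FirstOrder.Language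

/-! ### A calculus of formulas evaluated in two structures at once. -/

section Uniform

variable {M N γ α β δ : Type*} [setLang.Structure M] [setLang.Structure N]

/-- `P` and `Q` are defined in `M` and `N` by one formula, with parameters interpreted along `c`
and `d`. For `P = Q` and `c = d` this is definability with parameters from `c`. -/
def Unif (c : γ → M) (d : γ → N) (P : (α → M) → Prop) (Q : (α → N) → Prop) : Prop :=
  ∃ φ : setLang.Formula (γ ⊕ α), (∀ v, P v ↔ φ.Realize (Sum.elim c v)) ∧
    ∀ v, Q v ↔ φ.Realize (Sum.elim d v)

/-- `s` and `t` are given in `M` and `N` by one term, with parameters. -/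
def UTerm (c : γ → M) (d : γ → N) (s : (α → M) → M) (t : (α → N) → N) : Prop :=
  ∃ τ : setLang.Term (γ ⊕ α), (∀ v, s v = τ.realize (Sum.elim c v)) ∧
    ∀ v, t v = τ.realize (Sum.elim d v)

variable {c : γ → M} {d : γ → N} {P P' : (α → M) → Prop} {Q Q' : (α → N) → Prop}
  {s s' : (α → M) → M} {t t' : (α → N) → N}

theorem UTerm.var (i : α) : UTerm c d (fun v => v i) (fun v => v i) :=
  ⟨Term.var (Sum.inr i), fun _ => rfl, fun _ => rfl⟩

theorem UTerm.param (g : γ) : UTerm c d (fun _ : α → M => c g) (fun _ => d g) :=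
  ⟨Term.var (Sum.inl g), fun _ => rfl, fun _ => rfl⟩

theorem UTerm.comp (h : UTerm c d s t) (g : α → β) :
    UTerm c d (fun w : β → M => s (fun i => w (g i))) (fun w => t (fun i => w (g i))) := by
  obtain ⟨τ, h1, h2⟩ := h
  refine ⟨τ.relabel (Sum.map id g), fun v => ?_, fun v => ?_⟩
  · beta_reduce; rw [h1, Term.realize_relabel, Sum.elim_comp_map]; rfl
  · beta_reduce; rw [h2, Term.realize_relabel, Sum.elim_comp_map]; rfl

theorem UTerm.weak (h : UTerm c d s t) :
    UTerm c d (fun w : Option α → M => s (fun i => w (some i))) (fun w => t (fun i => w (some i))) :=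
  h.comp some

theorem UTerm.choice (h : UTerm c d s t) :
    UTerm c d (fun v => choiceFun (s v)) (fun v => choiceFun (t v)) := by
  obtain ⟨τ, h1, h2⟩ := h
  refine ⟨choiceSym.apply₁ τ, fun v => ?_, fun v => ?_⟩
  · simp [h1, choiceFun, Term.realize_functions_apply₁]
  · simp [h2, choiceFun, Term.realize_functions_apply₁]

theorem Unif.mem (h : UTerm c d s t) (h' : UTerm c d s' t') :
    Unif c d (fun v => s v ∈ₘ s' v) (fun v => t v ∈ₘ t' v) := by
  obtain ⟨τ, h1, h2⟩ := h
  obtain ⟨τ', h1', h2'⟩ := h'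
  refine ⟨memSym.formula₂ τ τ', fun v => ?_, fun v => ?_⟩
  · simp [h1, h1', Mem, Formula.realize_rel₂]
  · simp [h2, h2', Mem, Formula.realize_rel₂]

theorem Unif.eq (h : UTerm c d s t) (h' : UTerm c d s' t') :
    Unif c d (fun v => s v = s' v) (fun v => t v = t' v) := by
  obtain ⟨τ, h1, h2⟩ := h
  obtain ⟨τ', h1', h2'⟩ := h'
  refine ⟨τ.equal τ', fun v => ?_, fun v => ?_⟩
  · simp [h1, h1', Formula.realize_equal]
  · simp [h2, h2', Formula.realize_equal]

theorem Unif.not (h : Unif c d P Q) : Unif c d (fun v => ¬ P v) (fun v => ¬ Q v) := by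
  obtain ⟨φ, h1, h2⟩ := h
  exact ⟨φ.not, fun v => by simp [h1], fun v => by simp [h2]⟩

theorem Unif.imp (h : Unif c d P Q) (h' : Unif c d P' Q') :
    Unif c d (fun v => P v → P' v) (fun v => Q v → Q' v) := by
  obtain ⟨φ, h1, h2⟩ := h
  obtain ⟨φ', h1', h2'⟩ := h'
  exact ⟨φ.imp φ', fun v => by simp [h1, h1'], fun v => by simp [h2, h2']⟩

theorem Unif.congr (h : Unif c d P Q) (hP : ∀ v, P' v ↔ P v) (hQ : ∀ v, Q' v ↔ Q v) :
    Unif c d P' Q' := by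
  obtain ⟨φ, h1, h2⟩ := h
  exact ⟨φ, fun v => (hP v).trans (h1 v), fun v => (hQ v).trans (h2 v)⟩

theorem Unif.and (h : Unif c d P Q) (h' : Unif c d P' Q') :
    Unif c d (fun v => P v ∧ P' v) (fun v => Q v ∧ Q' v) :=
  (h.imp h'.not).not.congr (fun v => by tauto) (fun v => by tauto)

theorem Unif.or (h : Unif c d P Q) (h' : Unif c d P' Q') :
    Unif c d (fun v => P v ∨ P' v) (fun v => Q v ∨ Q' v) :=
  (h.not.imp h').congr (fun v => by tauto) (fun v => by tauto)

theorem Unif.iff (h : Unif c d P Q) (h' : Unif c d P' Q') :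
    Unif c d (fun v => P v ↔ P' v) (fun v => Q v ↔ Q' v) :=
  ((h.imp h').and (h'.imp h)).congr (fun v => by tauto) (fun v => by tauto)

theorem Unif.comp (h : Unif c d P Q) (g : α → β) :
    Unif c d (fun w : β → M => P (fun i => w (g i))) (fun w => Q (fun i => w (g i))) := by
  obtain ⟨φ, h1, h2⟩ := h
  refine ⟨φ.relabel (Sum.map id g), fun v => ?_, fun v => ?_⟩
  · beta_reduce; rw [h1, Formula.realize_relabel, Sum.elim_comp_map]; rfl
  · beta_reduce; rw [h2, Formula.realize_relabel, Sum.elim_comp_map]; rfl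

theorem Unif.allTuple [Finite β] {P : (α → M) → (β → M) → Prop} {Q : (α → N) → (β → N) → Prop}
    (h : Unif c d (fun w : α ⊕ β → M => P (fun i => w (Sum.inl i)) (fun i => w (Sum.inr i)))
      (fun w => Q (fun i => w (Sum.inl i)) (fun i => w (Sum.inr i)))) :
    Unif c d (fun v => ∀ x, P v x) (fun v => ∀ x, Q v x) := by
  obtain ⟨φ, h1, h2⟩ := h
  refine ⟨(φ.relabel (Equiv.sumAssoc γ α β).symm).iAlls β, fun v => ?_, fun v => ?_⟩
  · simp only [Formula.realize_iAlls, Formula.realize_relabel]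
    refine forall_congr' fun x => (h1 (Sum.elim v x)).trans ?_
    refine iff_of_eq (congrArg _ ?_)
    funext i; rcases i with i | i | i <;> rfl
  · simp only [Formula.realize_iAlls, Formula.realize_relabel]
    refine forall_congr' fun x => (h2 (Sum.elim v x)).trans ?_
    refine iff_of_eq (congrArg _ ?_)
    funext i; rcases i with i | i | i <;> rfl

theorem Unif.exTuple [Finite β] {P : (α → M) → (β → M) → Prop} {Q : (α → N) → (β → N) → Prop}
    (h : Unif c d (fun w : α ⊕ β → M => P (fun i => w (Sum.inl i)) (fun i => w (Sum.inr i)))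
      (fun w => Q (fun i => w (Sum.inl i)) (fun i => w (Sum.inr i)))) :
    Unif c d (fun v => ∃ x, P v x) (fun v => ∃ x, Q v x) :=
  (Unif.allTuple (P := fun v x => ¬ P v x) (Q := fun v x => ¬ Q v x) h.not).not.congr
    (fun v => by simp) (fun v => by simp)

/-- The bound variable becomes the new index `none`, so a quantified goal reduces to a goal of the
same kind over `Option α`. Definability proofs thereby follow the syntax of the predicate. -/
theorem Unif.all {P : (α → M) → M → Prop} {Q : (α → N) → N → Prop}
    (h : Unif c d (fun w : Option α → M => P (fun i => w (some i)) (w none))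
      (fun w => Q (fun i => w (some i)) (w none))) :
    Unif c d (fun v => ∀ x, P v x) (fun v => ∀ x, Q v x) := by
  refine (Unif.allTuple (β := Unit) (P := fun v x => P v (x ())) (Q := fun v x => Q v (x ()))
    (h.comp (fun o => o.elim (Sum.inr ()) Sum.inl))).congr (fun v => ?_) (fun v => ?_)
  · exact ⟨fun h x => h _, fun h x => h (fun _ => x)⟩
  · exact ⟨fun h x => h _, fun h x => h (fun _ => x)⟩

theorem Unif.ex {P : (α → M) → M → Prop} {Q : (α → N) → N → Prop}
    (h : Unif c d (fun w : Option α → M => P (fun i => w (some i)) (w none))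
      (fun w => Q (fun i => w (some i)) (w none))) :
    Unif c d (fun v => ∃ x, P v x) (fun v => ∃ x, Q v x) :=
  (Unif.all (P := fun v x => ¬ P v x) (Q := fun v x => ¬ Q v x) h.not).not.congr
    (fun v => by simp) (fun v => by simp)

theorem Unif.iAnd {ι : Type*} [Finite ι] {P : ι → (α → M) → Prop} {Q : ι → (α → N) → Prop}
    (h : ∀ i, Unif c d (P i) (Q i)) : Unif c d (fun v => ∀ i, P i v) (fun v => ∀ i, Q i v) := by
  choose φ h1 h2 using h
  exact ⟨Formula.iInf φ, fun v => by simp [h1], fun v => by simp [h2]⟩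

theorem Unif.formula (φ : setLang.Formula (β ⊕ δ)) (g : β → α) (h : δ → α) :
    Unif c d (fun v => φ.Realize (Sum.elim (fun i => v (g i)) (fun i => v (h i))))
      (fun v => φ.Realize (Sum.elim (fun i => v (g i)) (fun i => v (h i)))) := by
  refine ⟨φ.relabel (Sum.elim (fun i => Sum.inr (g i)) (fun i => Sum.inr (h i))), fun v => ?_,
    fun v => ?_⟩ <;>
  · rw [Formula.realize_relabel]
    refine iff_of_eq (congrArg _ ?_)
    funext i; rcases i with i | i <;> rfl

theorem Unif.formulaParam (φ : setLang.Formula (γ ⊕ δ)) (h : δ → α) :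
    Unif c d (fun v => φ.Realize (Sum.elim c (fun i => v (h i))))
      (fun v => φ.Realize (Sum.elim d (fun i => v (h i)))) := by
  refine ⟨φ.relabel (Sum.map id h), fun v => ?_, fun v => ?_⟩ <;>
  · rw [Formula.realize_relabel, Sum.elim_comp_map]
    rfl

theorem Unif.rebase {γ' : Type*} (h : Unif c d P Q) {c' : γ' → M} {d' : γ' → N} (g : γ → γ')
    (hc : ∀ i, c' (g i) = c i) (hd : ∀ i, d' (g i) = d i) : Unif c' d' P Q := by
  obtain ⟨φ, h1, h2⟩ := h
  refine ⟨φ.relabel (Sum.map g id), fun v => ?_, fun v => ?_⟩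
  · rw [Formula.realize_relabel, Sum.elim_comp_map, h1, show c' ∘ g = c from funext hc]; rfl
  · rw [Formula.realize_relabel, Sum.elim_comp_map, h2, show d' ∘ g = d from funext hd]; rfl

theorem Unif.transfer {f : M ↪ₑ[setLang] N} {c : γ → M} (h : Unif c (fun g => f (c g)) P Q)
    (v : α → M) : Q (fun i => f (v i)) ↔ P v := by
  obtain ⟨φ, h1, h2⟩ := h
  rw [h1, h2, ← f.map_formula]
  refine iff_of_eq (congrArg _ ?_)
  funext i; rcases i with i | i <;> rfl

end Uniform

/-! ### Definability with parameters in one structure. -/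

section Definability

variable {M γ α β : Type*} [setLang.Structure M]

/-- Definability of a predicate with parameters from the range of `c`. -/
abbrev Dfn (c : γ → M) (P : (α → M) → Prop) : Prop := Unif c c P P

variable {c : γ → M} {P : (α → M) → Prop}

theorem dfn_iff : Dfn c P ↔ ∃ φ : setLang.Formula (γ ⊕ α), ∀ v, P v ↔ φ.Realize (Sum.elim c v) :=
  ⟨fun ⟨φ, h, _⟩ => ⟨φ, h⟩, fun ⟨φ, h⟩ => ⟨φ, h, h⟩⟩

theorem Dfn.toId (h : Dfn c P) : Dfn (id : M → M) P := h.rebase c (fun _ => rfl) (fun _ => rfl)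

theorem dfn_iff_definable {A : Set M} (hA : Set.range c = A) :
    Dfn c P ↔ A.Definable setLang {v | P v} := by
  subst hA
  rw [dfn_iff, Set.definable_iff_exists_formula_sum]
  constructor
  · rintro ⟨φ, h⟩
    refine ⟨φ.relabel (Sum.map (fun g => ⟨c g, g, rfl⟩) id), ?_⟩
    ext v
    simp only [Set.mem_ofPred_eq, h, Formula.realize_relabel, Sum.elim_comp_map]
    rfl
  · rintro ⟨φ, h⟩
    choose g hg using fun x : Set.range c => x.2
    refine ⟨φ.relabel (Sum.map g id), fun v => ?_⟩
    have := Set.ext_iff.1 h v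
    simp only [Set.mem_ofPred_eq] at this
    rw [this, Formula.realize_relabel, Sum.elim_comp_map, show c ∘ g = _ from funext hg]
    rfl

theorem Dfn.inst (h : Dfn c P) (g : α → γ ⊕ β) :
    Dfn c (fun w : β → M => P (fun i => Sum.elim c w (g i))) := by
  obtain ⟨φ, h1, -⟩ := h
  refine dfn_iff.2 ⟨φ.relabel (Sum.elim Sum.inl g), fun v => ?_⟩
  rw [Formula.realize_relabel]
  refine (h1 _).trans (iff_of_eq (congrArg _ ?_))
  funext i; rcases i with i | i <;> rfl

/-- Parameters can be added as variables: a predicate that is definable from the values of `c`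
and of `e` is obtained by substituting `e` into one definable from `c`. -/
theorem Dfn.exists_subst {e : β → M} (h : Dfn (Sum.elim c e) P) :
    ∃ R : (β → M) → (α → M) → Prop,
      Dfn c (fun w : β ⊕ α → M => R (fun i => w (Sum.inl i)) (fun i => w (Sum.inr i))) ∧
        ∀ v, P v ↔ R e v := by
  obtain ⟨φ, h1, -⟩ := h
  refine ⟨fun b v => φ.Realize (Sum.elim (Sum.elim c b) v), dfn_iff.2
    ⟨φ.relabel (Equiv.sumAssoc γ β α), fun w => ?_⟩, h1⟩
  rw [Formula.realize_relabel]
  refine iff_of_eq (congrArg _ ?_)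
  funext i; rcases i with (i | i) | i <;> rfl

end Definability

/-! ### Compactness for directed unions of sets of formulas. -/

section Compactness

variable {L : FirstOrder.Language.{0, 0}}

/-- Compactness for sets of formulas, for a directed union. -/
theorem exists_realize_iUnion {γ : Type u} {ι : Type*} [Nonempty ι] {Φ : ι → Set (L.Formula γ)}
    (hd : Directed (· ⊆ ·) Φ)
    (h : ∀ i, ∃ (K : Type v) (_ : L.Structure K) (_ : Nonempty K) (e : γ → K),
      ∀ φ ∈ Φ i, φ.Realize e) :
    ∃ (K : Type u) (_ : L.Structure K) (e : γ → K), ∀ i, ∀ φ ∈ Φ i, φ.Realize e := by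
  have hsat : Theory.IsSatisfiable (⋃ i, Formula.equivSentence '' Φ i) := by
    rw [Theory.isSatisfiable_directed_union_iff]
    · intro i
      obtain ⟨K, _, _, e, he⟩ := h i
      let := constantsOn.structure e
      have : K ⊨ Formula.equivSentence '' Φ i := by
        refine ⟨?_⟩
        rintro _ ⟨φ, hφ, rfl⟩
        rw [Formula.realize_equivSentence]
        exact he φ hφ
      exact Theory.Model.isSatisfiable K
    · intro i j
      obtain ⟨k, hi, hj⟩ := hd i j
      exact ⟨k, Set.image_mono hi, Set.image_mono hj⟩
  obtain ⟨K⟩ := hsat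
  let : L.Structure K := (L.lhomWithConstants γ).reduct K
  have : (L.lhomWithConstants γ).IsExpansionOn K := LHom.isExpansionOn_reduct _ _
  refine ⟨K, inferInstance, fun a => (L.con a : K), fun i φ hφ => ?_⟩
  rw [← Formula.realize_equivSentence]
  exact Theory.realize_sentence_of_mem (⋃ i, Formula.equivSentence '' Φ i)
    (Set.mem_iUnion.2 ⟨i, Set.mem_image_of_mem _ hφ⟩)

end Compactness

/-! ### Definability of the basic notions about `ω`. -/

section Basic

variable {M N γ α : Type*} [setLang.Structure M] [setLang.Structure N]
  {c : γ → M} {d : γ → N} {s s' : (α → M) → M} {t t' : (α → N) → N}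

theorem Unif.isSuccOf (h : UTerm c d s t) (h' : UTerm c d s' t') :
    Unif c d (fun v => IsSuccOf (s v) (s' v)) (fun v => IsSuccOf (t v) (t' v)) := by
  apply Unif.all
  exact (Unif.mem (UTerm.var _) h.weak).iff
    ((Unif.mem (UTerm.var _) h'.weak).or (Unif.eq (UTerm.var _) h'.weak))

theorem Unif.isInductive (h : UTerm c d s t) :
    Unif c d (fun v => IsInductive (s v)) (fun v => IsInductive (t v)) := by
  unfold IsInductive
  repeat'
    first
    | with_reducible apply Unif.and | with_reducible apply Unif.or | with_reducible apply Unif.all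
    | with_reducible apply Unif.ex | with_reducible apply Unif.not | with_reducible apply Unif.imp
    | with_reducible apply Unif.iff
    | apply Unif.mem | apply Unif.eq | exact UTerm.var _ | apply Unif.isSuccOf | exact h
    | exact h.weak | exact h.weak.weak

theorem Unif.isOmega (h : UTerm c d s t) :
    Unif c d (fun v => IsOmega (s v)) (fun v => IsOmega (t v)) := by
  unfold IsOmega
  repeat'
    first
    | with_reducible apply Unif.and | with_reducible apply Unif.or | with_reducible apply Unif.all
    | with_reducible apply Unif.ex | with_reducible apply Unif.not | with_reducible apply Unif.imp
    | with_reducible apply Unif.iff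
    | apply Unif.mem | apply Unif.eq | exact UTerm.var _ | apply Unif.isInductive | exact h
    | exact h.weak | exact h.weak.weak

theorem Unif.memOmegaSet (h : UTerm c d s t) :
    Unif c d (fun v => s v ∈ omegaSet M) (fun v => t v ∈ omegaSet N) := by
  apply Unif.ex
  exact (Unif.isOmega (UTerm.var _)).and (Unif.mem h.weak (UTerm.var _))

end Basic

section Schemes

variable {M : Type u} [setLang.Structure M]

theorem IsModelZFGC.sep (hM : IsModelZFGC M) {γ : Type*} {c : γ → M} {D : M → Prop}
    (hD : Dfn c (fun v : Fin 1 → M => D (v 0))) (x : M) :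
    ∃ z : M, ∀ t : M, t ∈ₘ z ↔ t ∈ₘ x ∧ D t :=
  hM.separation {t | D t} ((dfn_iff_definable (by simp)).1 hD.toId) x

theorem IsModelZFGC.repl (hM : IsModelZFGC M) {γ : Type*} {c : γ → M} {R : M → M → Prop}
    (hR : Dfn c (fun v : Fin 2 → M => R (v 0) (v 1))) (x : M)
    (h : ∀ s, s ∈ₘ x → ∃! t, R s t) :
    ∃ z : M, ∀ t : M, t ∈ₘ z ↔ ∃ s : M, s ∈ₘ x ∧ R s t :=
  hM.replacement R ((dfn_iff_definable (by simp)).1 hR.toId) x h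

end Schemes

/-! ### Transfer of ZFGC along elementary embeddings. -/

section Transfer

variable {M : Type u} {N : Type v} [setLang.Structure M] [setLang.Structure N]

theorem transfer_sentence (f : M ↪ₑ[setLang] N) {P Q : Prop}
    (h : Unif (Empty.elim : Empty → M) (Empty.elim : Empty → N) (fun _ : Empty → M => P)
      (fun _ => Q)) (hP : P) : Q := by
  have h' : Unif (Empty.elim : Empty → M) (fun g => f (Empty.elim g)) (fun _ : Empty → M => P)
      (fun _ => Q) := h.rebase id (fun i => i.elim) (fun i => i.elim)
  exact (h'.transfer Empty.elim).2 hP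

/-- A formula mentions finitely many parameters; indexed by `Fin k`, they can be quantified away. -/
theorem Dfn.exists_finite_params {γ α : Type*} {c : γ → N} {P : (α → N) → Prop} (h : Dfn c P) :
    ∃ (k : ℕ) (g : Fin k → γ) (φ : setLang.Formula (Fin k ⊕ α)),
      ∀ v, P v ↔ φ.Realize (Sum.elim (fun i => c (g i)) v) := by
  have h1 := (dfn_iff_definable rfl).1 h
  rw [Set.definable_iff_finitely_definable] at h1
  obtain ⟨A, hAc, hA⟩ := h1
  choose g hg using fun x : A => hAc x.2
  let e := A.equivFin
  have h2 : Dfn (fun i => c (g (e.symm i))) P := by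
    refine (dfn_iff_definable (A := (A : Set N)) ?_).2 hA
    ext x
    constructor
    · rintro ⟨i, rfl⟩
      simp [hg]
    · intro hx
      exact ⟨e ⟨x, hx⟩, by simp [hg]⟩
  obtain ⟨φ, hφ⟩ := dfn_iff.1 h2
  exact ⟨_, _, φ, hφ⟩

/-- The single axioms are sentences. A scheme instance with parameters from `N` is not, but
universal quantification over its finitely many parameters makes it one, and this sentence holds in
`M` by the same scheme. -/
theorem IsModelZFGC.transfer (hM : IsModelZFGC M) (f : M ↪ₑ[setLang] N) : IsModelZFGC N where
  extensionality := transfer_sentence f (by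
    repeat'
      first
      | with_reducible apply Unif.and | with_reducible apply Unif.or | with_reducible apply Unif.all
      | with_reducible apply Unif.ex | with_reducible apply Unif.not
      | with_reducible apply Unif.imp | with_reducible apply Unif.iff
      | apply Unif.mem | apply Unif.eq | exact UTerm.var _) hM.extensionality
  foundation := transfer_sentence f (by
    repeat'
      first
      | with_reducible apply Unif.and | with_reducible apply Unif.or | with_reducible apply Unif.all
      | with_reducible apply Unif.ex | with_reducible apply Unif.not
      | with_reducible apply Unif.imp | with_reducible apply Unif.iff
      | apply Unif.mem | apply Unif.eq | exact UTerm.var _) hM.foundation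
  pairing := transfer_sentence f (by
    repeat'
      first
      | with_reducible apply Unif.and | with_reducible apply Unif.or | with_reducible apply Unif.all
      | with_reducible apply Unif.ex | with_reducible apply Unif.not
      | with_reducible apply Unif.imp | with_reducible apply Unif.iff
      | apply Unif.mem | apply Unif.eq | exact UTerm.var _) hM.pairing
  union := transfer_sentence f (by
    repeat'
      first
      | with_reducible apply Unif.and | with_reducible apply Unif.or | with_reducible apply Unif.all
      | with_reducible apply Unif.ex | with_reducible apply Unif.not
      | with_reducible apply Unif.imp | with_reducible apply Unif.iff
      | apply Unif.mem | apply Unif.eq | exact UTerm.var _) hM.union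
  power := transfer_sentence f (by
    repeat'
      first
      | with_reducible apply Unif.and | with_reducible apply Unif.or | with_reducible apply Unif.all
      | with_reducible apply Unif.ex | with_reducible apply Unif.not
      | with_reducible apply Unif.imp | with_reducible apply Unif.iff
      | apply Unif.mem | apply Unif.eq | exact UTerm.var _) hM.power
  infinity := transfer_sentence f (by
    apply Unif.ex
    exact Unif.isInductive (UTerm.var _)) hM.infinity
  globalChoice := transfer_sentence f (by
    repeat'
      first
      | with_reducible apply Unif.and | with_reducible apply Unif.or | with_reducible apply Unif.all
      | with_reducible apply Unif.ex | with_reducible apply Unif.not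
      | with_reducible apply Unif.imp | with_reducible apply Unif.iff
      | apply Unif.mem | apply Unif.eq | exact UTerm.var _
      | exact (UTerm.var _).choice) hM.globalChoice
  separation D hD := by
    have hD' : Dfn (id : N → N) (fun v : Fin 1 → N => v 0 ∈ D) :=
      (dfn_iff_definable (by simp)).2 hD
    obtain ⟨k, y, φ, hφ⟩ := hD'.exists_finite_params
    have key : ∀ y : Fin k → N, ∀ x : N, ∃ z : N, ∀ t : N, t ∈ₘ z ↔ t ∈ₘ x ∧
        φ.Realize (Sum.elim y (fun _ => t)) := by
      refine transfer_sentence f (P := ∀ y : Fin k → M, ∀ x : M, ∃ z : M, ∀ t : M, t ∈ₘ z ↔ t ∈ₘ x ∧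
        φ.Realize (Sum.elim y (fun _ => t))) ?_ ?_
      · apply Unif.allTuple
        apply Unif.all
        apply Unif.ex
        apply Unif.all
        refine (Unif.mem (UTerm.var _) (UTerm.var _)).iff
          ((Unif.mem (UTerm.var _) (UTerm.var _)).and ?_)
        exact Unif.formula φ (fun i => some (some (some (Sum.inr i)))) (fun _ => none)
      · intro y x
        refine hM.sep (c := y) (D := fun t => φ.Realize (Sum.elim y (fun _ => t))) ?_ x
        exact Unif.formulaParam φ (fun _ => 0)
    intro x
    obtain ⟨z, hz⟩ := key y x
    refine ⟨z, fun t => (hz t).trans (and_congr_right fun _ => ?_)⟩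
    exact (hφ (fun _ => t)).symm
  replacement R hR := by
    have hR' : Dfn (id : N → N) (fun v : Fin 2 → N => R (v 0) (v 1)) :=
      (dfn_iff_definable (by simp)).2 hR
    obtain ⟨k, y, φ, hφ⟩ := hR'.exists_finite_params
    -- Unique existence is written as an existential over a biconditional, a form built from the
    -- connectives of the calculus.
    have key : ∀ y : Fin k → N, ∀ x : N,
        (∀ s : N, s ∈ₘ x → ∃ t : N, ∀ t', φ.Realize (Sum.elim y ![s, t']) ↔ t' = t) →
        ∃ z : N, ∀ t : N, t ∈ₘ z ↔ ∃ s : N, s ∈ₘ x ∧ φ.Realize (Sum.elim y ![s, t]) := by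
      refine transfer_sentence f (P := ∀ y : Fin k → M, ∀ x : M,
        (∀ s : M, s ∈ₘ x → ∃ t : M, ∀ t', φ.Realize (Sum.elim y ![s, t']) ↔ t' = t) →
        ∃ z : M, ∀ t : M, t ∈ₘ z ↔ ∃ s : M, s ∈ₘ x ∧ φ.Realize (Sum.elim y ![s, t])) ?_ ?_
      · apply Unif.allTuple
        apply Unif.all
        apply Unif.imp
        · apply Unif.all
          refine (Unif.mem (UTerm.var _) (UTerm.var _)).imp ?_
          apply Unif.ex
          apply Unif.all
          refine Unif.iff ?_ (Unif.eq (UTerm.var _) (UTerm.var _))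
          refine (Unif.formula φ (fun i => some (some (some (some (Sum.inr i)))))
            (![some (some none), none] : Fin 2 → _)).congr ?_ ?_ <;>
          · intro v
            refine iff_of_eq (congrArg _ (congrArg _ ?_))
            funext i
            fin_cases i <;> rfl
        · apply Unif.ex
          apply Unif.all
          refine (Unif.mem (UTerm.var _) (UTerm.var _)).iff ?_
          apply Unif.ex
          refine (Unif.mem (UTerm.var _) (UTerm.var _)).and ?_
          refine (Unif.formula φ (fun i => some (some (some (some (Sum.inr i)))))
            (![none, some none] : Fin 2 → _)).congr ?_ ?_ <;>
          · intro v
            refine iff_of_eq (congrArg _ (congrArg _ ?_))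
            funext i
            fin_cases i <;> rfl
      · intro y x h
        refine hM.repl (c := y) (R := fun s t => φ.Realize (Sum.elim y ![s, t])) ?_ x ?_
        · refine (Unif.formulaParam φ id).congr ?_ ?_ <;>
          · intro v
            refine iff_of_eq (congrArg _ (congrArg _ ?_))
            funext i
            fin_cases i <;> rfl
        · intro s hs
          obtain ⟨t, ht⟩ := h s hs
          exact ⟨t, (ht t).2 rfl, fun t' h' => (ht t').1 h'⟩
    have hφ' : ∀ s t, R s t ↔ φ.Realize (Sum.elim y ![s, t]) := fun s t => hφ ![s, t]
    intro x hx
    simp only [hφ'] at hx ⊢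
    refine key y x fun s hs => ?_
    obtain ⟨t, ht, ht'⟩ := hx s hs
    exact ⟨t, fun t' => ⟨fun h => ht' t' h, fun h => h ▸ ht⟩⟩

end Transfer

/-! ### Natural numbers, transitive closures and foundation for classes. -/

section SetTheory

variable {M : Type u} [setLang.Structure M]

/-- `e` is the empty set. -/
def IsEmptySet (e : M) : Prop := ∀ z : M, ¬ z ∈ₘ e

/-- `u` is the union of the members of `x`. -/
def IsUnionOf (u x : M) : Prop := ∀ t : M, t ∈ₘ u ↔ ∃ y : M, y ∈ₘ x ∧ t ∈ₘ y

/-- `x ⊆ y`. -/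
def Sub (x y : M) : Prop := ∀ z : M, z ∈ₘ x → z ∈ₘ y

/-- `x` is a transitive set. -/
def IsTrans (x : M) : Prop := ∀ y : M, y ∈ₘ x → Sub y x

/-- `p` is the Kuratowski pair of `a` and `b`. -/
def IsPair (p a b : M) : Prop :=
  ∀ z : M, z ∈ₘ p ↔ (∀ t, t ∈ₘ z ↔ t = a) ∨ ∀ t, t ∈ₘ z ↔ t = a ∨ t = b

/-- Every pair `(k, y)` in `a` is `(0, x)` or of the form `(j + 1, ⋃ w)` with `(j, w) ∈ a`. -/
def IsDerivation (x a : M) : Prop :=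
  ∀ p : M, p ∈ₘ a → ∀ k y : M, IsPair p k y → (IsEmptySet k ∧ y = x) ∨
    ∃ j w q : M, IsSuccOf k j ∧ IsPair q j w ∧ q ∈ₘ a ∧ IsUnionOf y w

/-- `y` is the `n`-fold union of `x`. -/
def IsIterUnion (x n y : M) : Prop :=
  ∃ a p : M, IsDerivation x a ∧ IsPair p n y ∧ p ∈ₘ a

section Definability

variable {γ α : Type*} {c : γ → M} {s s' s'' : (α → M) → M}

theorem Dfn.isEmptySet (h : UTerm c c s s) : Dfn c (fun v => IsEmptySet (s v)) := by
  unfold IsEmptySet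
  repeat'
    first
    | with_reducible apply Unif.and | with_reducible apply Unif.or | with_reducible apply Unif.all
    | with_reducible apply Unif.ex | with_reducible apply Unif.not | with_reducible apply Unif.imp
    | with_reducible apply Unif.iff
    | apply Unif.mem | apply Unif.eq | exact UTerm.var _ | exact h.weak

theorem Dfn.isUnionOf (h : UTerm c c s s) (h' : UTerm c c s' s') :
    Dfn c (fun v => IsUnionOf (s v) (s' v)) := by
  unfold IsUnionOf
  repeat'
    first
    | with_reducible apply Unif.and | with_reducible apply Unif.or | with_reducible apply Unif.all
    | with_reducible apply Unif.ex | with_reducible apply Unif.not | with_reducible apply Unif.imp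
    | with_reducible apply Unif.iff
    | apply Unif.mem | apply Unif.eq | exact UTerm.var _ | exact h.weak | exact h'.weak.weak

theorem Dfn.sub (h : UTerm c c s s) (h' : UTerm c c s' s') :
    Dfn c (fun v => Sub (s v) (s' v)) := by
  unfold Sub
  repeat'
    first
    | with_reducible apply Unif.and | with_reducible apply Unif.or | with_reducible apply Unif.all
    | with_reducible apply Unif.ex | with_reducible apply Unif.not | with_reducible apply Unif.imp
    | with_reducible apply Unif.iff
    | apply Unif.mem | apply Unif.eq | exact UTerm.var _ | exact h.weak | exact h'.weak

theorem Dfn.isPair (h : UTerm c c s s) (h' : UTerm c c s' s') (h'' : UTerm c c s'' s'') :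
    Dfn c (fun v => IsPair (s v) (s' v) (s'' v)) := by
  unfold IsPair
  repeat'
    first
    | with_reducible apply Unif.and | with_reducible apply Unif.or | with_reducible apply Unif.all
    | with_reducible apply Unif.ex | with_reducible apply Unif.not | with_reducible apply Unif.imp
    | with_reducible apply Unif.iff
    | apply Unif.mem | apply Unif.eq | exact UTerm.var _ | exact h.weak | exact h'.weak.weak
    | exact h''.weak.weak

theorem Dfn.isDerivation (h : UTerm c c s s) (h' : UTerm c c s' s') :
    Dfn c (fun v => IsDerivation (s v) (s' v)) := by
  unfold IsDerivation
  repeat'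
    first
    | with_reducible apply Unif.and | with_reducible apply Unif.or | with_reducible apply Unif.all
    | with_reducible apply Unif.ex | with_reducible apply Unif.not | with_reducible apply Unif.imp
    | with_reducible apply Unif.iff
    | apply Unif.mem | apply Unif.eq | exact UTerm.var _ | apply Dfn.isPair | apply Dfn.isEmptySet
    | apply Dfn.isUnionOf | apply Unif.isSuccOf | exact h.weak.weak.weak | exact h'.weak
    | exact h'.weak.weak.weak.weak.weak.weak

theorem Dfn.isIterUnion (h : UTerm c c s s) (h' : UTerm c c s' s') (h'' : UTerm c c s'' s'') :
    Dfn c (fun v => IsIterUnion (s v) (s' v) (s'' v)) := by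
  unfold IsIterUnion
  repeat'
    first
    | with_reducible apply Unif.and | with_reducible apply Unif.or | with_reducible apply Unif.all
    | with_reducible apply Unif.ex | with_reducible apply Unif.not | with_reducible apply Unif.imp
    | with_reducible apply Unif.iff
    | apply Unif.mem | apply Unif.eq | exact UTerm.var _ | apply Dfn.isPair
    | apply Dfn.isDerivation | exact h.weak.weak | exact h'.weak.weak | exact h''.weak.weak

end Definability

namespace IsModelZFGC



theorem exists_empty (hM : IsModelZFGC M) : ∃ e : M, IsEmptySet e := by
  obtain ⟨w, ⟨e, he, -⟩, -⟩ := hM.infinity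
  exact ⟨e, he⟩

theorem eq_of_isEmptySet (hM : IsModelZFGC M) {e e' : M} (h : IsEmptySet e) (h' : IsEmptySet e') : e = e' :=
  hM.extensionality _ _ fun z => iff_of_false (h z) (h' z)

theorem exists_insert (hM : IsModelZFGC M) (a x : M) : ∃ y : M, ∀ z : M, z ∈ₘ y ↔ z ∈ₘ a ∨ z = x := by
  obtain ⟨s, hs⟩ := hM.pairing x x
  obtain ⟨p, hp⟩ := hM.pairing a s
  obtain ⟨u, hu⟩ := hM.union p
  refine ⟨u, fun z => (hu z).trans ⟨?_, ?_⟩⟩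
  · rintro ⟨y, hy, hz⟩
    rcases (hp y).1 hy with rfl | rfl
    · exact Or.inl hz
    · exact Or.inr (by simpa using (hs z).1 hz)
  · rintro (hz | hz)
    · exact ⟨a, (hp a).2 (Or.inl rfl), hz⟩
    · exact ⟨s, (hp s).2 (Or.inr rfl), (hs z).2 (Or.inl hz)⟩

theorem not_mem_mem (hM : IsModelZFGC M) (x y : M) : ¬ (x ∈ₘ y ∧ y ∈ₘ x) := by
  rintro ⟨h, h'⟩
  obtain ⟨p, hp⟩ := hM.pairing x y
  obtain ⟨z, hz, hz'⟩ := hM.foundation p ⟨x, (hp x).2 (Or.inl rfl)⟩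
  rcases (hp z).1 hz with rfl | rfl
  · exact hz' y ⟨h', (hp y).2 (Or.inr rfl)⟩
  · exact hz' x ⟨h, (hp x).2 (Or.inl rfl)⟩

theorem not_mem_self (hM : IsModelZFGC M) (x : M) : ¬ x ∈ₘ x := fun h => hM.not_mem_mem x x ⟨h, h⟩

theorem exists_succ (hM : IsModelZFGC M) (x : M) : ∃ y : M, IsSuccOf y x := hM.exists_insert x x

theorem succ_unique (hM : IsModelZFGC M) {x y y' : M} (h : IsSuccOf y x) (h' : IsSuccOf y' x) : y = y' :=
  hM.extensionality _ _ fun z => (h z).trans (h' z).symm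

theorem succ_inj (hM : IsModelZFGC M) {x x' y : M} (h : IsSuccOf y x) (h' : IsSuccOf y x') : x = x' := by
  by_contra hne
  have h1 : x ∈ₘ x' := ((h' x).1 ((h x).2 (Or.inr rfl))).resolve_right hne
  have h2 : x' ∈ₘ x := ((h x').1 ((h' x').2 (Or.inr rfl))).resolve_right fun e => hne e.symm
  exact hM.not_mem_mem x x' ⟨h1, h2⟩

theorem union_unique (hM : IsModelZFGC M) {u u' x : M} (h : IsUnionOf u x) (h' : IsUnionOf u' x) : u = u' :=
  hM.extensionality _ _ fun z => (h z).trans (h' z).symm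

theorem exists_pair (hM : IsModelZFGC M) (a b : M) : ∃ p : M, IsPair p a b := by
  obtain ⟨s, hs⟩ := hM.pairing a a
  obtain ⟨t, ht⟩ := hM.pairing a b
  obtain ⟨p, hp⟩ := hM.pairing s t
  refine ⟨p, fun z => (hp z).trans (or_congr ⟨?_, ?_⟩ ⟨?_, ?_⟩)⟩
  · rintro rfl r
    simpa using hs r
  · intro h
    exact hM.extensionality _ _ fun r => by simp [h r, hs r]
  · rintro rfl r
    exact ht r
  · intro h
    exact hM.extensionality _ _ fun r => by simp [h r, ht r]

theorem pair_inj (hM : IsModelZFGC M) {p a b a' b' : M} (h : IsPair p a b) (h' : IsPair p a' b') :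
    a = a' ∧ b = b' := by
  obtain ⟨s, hs⟩ := hM.pairing a a
  obtain ⟨s', hs'⟩ := hM.pairing a' a'
  obtain ⟨t, ht⟩ := hM.pairing a b
  obtain ⟨t', ht'⟩ := hM.pairing a' b'
  simp only [or_self] at hs hs'
  have e1 := (h' s).1 ((h s).2 (Or.inl hs))
  have e2 := (h' t).1 ((h t).2 (Or.inr ht))
  have e4 := (h t').1 ((h' t').2 (Or.inr ht'))
  have ha : a = a' := by
    rcases e1 with e | e
    · exact (e a).1 ((hs a).2 rfl)
    · exact ((hs a').1 ((e a').2 (Or.inl rfl))).symm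
  subst ha
  refine ⟨rfl, ?_⟩
  have f1 : b = a ∨ b = b' := by
    rcases e2 with e | e
    · exact Or.inl ((e b).1 ((ht b).2 (Or.inr rfl)))
    · exact (e b).1 ((ht b).2 (Or.inr rfl))
  have f2 : b' = a ∨ b' = b := by
    rcases e4 with e | e
    · exact Or.inl ((e b').1 ((ht' b').2 (Or.inr rfl)))
    · exact (e b').1 ((ht' b').2 (Or.inr rfl))
  grind

theorem exists_isOmega (hM : IsModelZFGC M) : ∃ w : M, IsOmega w := by
  obtain ⟨W, hW⟩ := hM.infinity
  obtain ⟨w, hw⟩ := hM.sep (c := (id : M → M)) (D := fun x => ∀ w' : M, IsInductive w' → x ∈ₘ w') (by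
    repeat'
      first
      | with_reducible apply Unif.and | with_reducible apply Unif.or | with_reducible apply Unif.all
      | with_reducible apply Unif.ex | with_reducible apply Unif.not
      | with_reducible apply Unif.imp | with_reducible apply Unif.iff
      | apply Unif.mem | apply Unif.eq | exact UTerm.var _ | apply Unif.isInductive) W
  refine ⟨w, ⟨?_, ?_⟩, fun w' hw' x hx => ((hw x).1 hx).2 w' hw'⟩
  · obtain ⟨e, he, -⟩ := hW.1
    have key : ∀ w' : M, IsInductive w' → e ∈ₘ w' := by
      rintro w' ⟨⟨e', he', h⟩, -⟩
      rwa [hM.eq_of_isEmptySet he he']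
    exact ⟨e, he, (hw e).2 ⟨key _ hW, key⟩⟩
  · intro x hx
    obtain ⟨y, hy⟩ := hM.exists_succ x
    have key : ∀ w' : M, IsInductive w' → y ∈ₘ w' := by
      intro w' hw'
      obtain ⟨y', hy', h⟩ := hw'.2 x (((hw x).1 hx).2 w' hw')
      rwa [hM.succ_unique hy hy']
    exact ⟨y, hy, (hw y).2 ⟨key _ hW, key⟩⟩

theorem zero_mem (hM : IsModelZFGC M) {e : M} (he : IsEmptySet e) : e ∈ omegaSet M := by
  obtain ⟨w, hw⟩ := hM.exists_isOmega
  obtain ⟨e', he', h⟩ := hw.1.1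
  exact ⟨w, hw, by rwa [hM.eq_of_isEmptySet he he']⟩

theorem succ_mem (hM : IsModelZFGC M) {x y : M} (hx : x ∈ omegaSet M) (h : IsSuccOf y x) : y ∈ omegaSet M := by
  obtain ⟨w, hw, hx⟩ := hx
  obtain ⟨y', hy', h'⟩ := hw.1.2 x hx
  exact ⟨w, hw, by rwa [hM.succ_unique h hy']⟩

/-- By separation the numbers satisfying `D` form a set; this set is inductive, so it contains all
of `ω` by leastness. -/
theorem omega_induction (hM : IsModelZFGC M) {γ : Type*} {c : γ → M} {D : M → Prop}
    (hD : Dfn c (fun v : Fin 1 → M => D (v 0))) (h0 : ∀ e, IsEmptySet e → D e)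
    (h1 : ∀ n ∈ omegaSet M, D n → ∀ m, IsSuccOf m n → D m) : ∀ n ∈ omegaSet M, D n := by
  rintro n ⟨w, hw, hn⟩
  obtain ⟨w', hw'⟩ := hM.sep hD w
  have hi : IsInductive w' := by
    constructor
    · obtain ⟨e, he, h⟩ := hw.1.1
      exact ⟨e, he, (hw' e).2 ⟨h, h0 e he⟩⟩
    · intro x hx
      obtain ⟨y, hy, h⟩ := hw.1.2 x ((hw' x).1 hx).1
      exact ⟨y, hy, (hw' y).2 ⟨h, h1 x ⟨w, hw, ((hw' x).1 hx).1⟩ ((hw' x).1 hx).2 y hy⟩⟩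
  exact ((hw' n).1 (hw.2 w' hi n hn)).2

theorem omega_trans (hM : IsModelZFGC M) {x y : M} (hx : x ∈ omegaSet M) (hy : y ∈ₘ x) : y ∈ omegaSet M := by
  have := hM.omega_induction (c := (id : M → M)) (D := fun x : M => ∀ y : M, y ∈ₘ x → y ∈ omegaSet M)
    (by
        repeat'
          first
          | with_reducible apply Unif.and | with_reducible apply Unif.or
          | with_reducible apply Unif.all
          | with_reducible apply Unif.ex | with_reducible apply Unif.not
          | with_reducible apply Unif.imp | with_reducible apply Unif.iff
          | apply Unif.mem | apply Unif.eq | exact UTerm.var _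
          | apply Unif.memOmegaSet) (fun e he y hy => absurd hy (he y))
    (fun n hn ih m hm y hy => by
      rcases (hm y).1 hy with h | rfl
      · exact ih y h
      · exact hn)
  exact this x hx y hy

theorem isTrans_of_mem_omega (hM : IsModelZFGC M) {x : M} (hx : x ∈ omegaSet M) : IsTrans x := by
  refine hM.omega_induction (c := (id : M → M)) (D := fun x : M => IsTrans x) ?_
    (fun e he y hy => absurd hy (he y)) (fun n hn ih m hm y hy z hz => ?_) x hx
  · unfold IsTrans
    repeat'
      first
      | with_reducible apply Unif.and | with_reducible apply Unif.or | with_reducible apply Unif.all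
      | with_reducible apply Unif.ex | with_reducible apply Unif.not
      | with_reducible apply Unif.imp | with_reducible apply Unif.iff
      | apply Unif.mem | apply Unif.eq | exact UTerm.var _ | apply Dfn.sub
  · refine (hm z).2 (Or.inl ?_)
    rcases (hm y).1 hy with h | rfl
    · exact ih y h z hz
    · exact hz

theorem succ_le_of_lt (hM : IsModelZFGC M) {n m s : M} (hm : m ∈ omegaSet M) (hs : IsSuccOf s n) (h : n ∈ₘ m) :
    s ∈ₘ m ∨ s = m := by
  refine hM.omega_induction (c := (id : M → M)) (D := fun m : M => n ∈ₘ m → s ∈ₘ m ∨ s = m) ?_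
    (fun e he h => absurd h (he n)) (fun k hk ih m hm h => ?_) m hm h
  ·
    repeat'
      first
      | with_reducible apply Unif.and | with_reducible apply Unif.or | with_reducible apply Unif.all
      | with_reducible apply Unif.ex | with_reducible apply Unif.not
      | with_reducible apply Unif.imp | with_reducible apply Unif.iff
      | apply Unif.mem | apply Unif.eq | exact UTerm.var _
      | exact UTerm.param _
  · rcases (hm n).1 h with h | rfl
    · rcases ih h with h | rfl
      · exact Or.inl ((hm _).2 (Or.inl h))
      · exact Or.inl ((hm _).2 (Or.inr rfl))
    · exact Or.inr (hM.succ_unique hs hm)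

theorem omega_trichotomy (hM : IsModelZFGC M) {x y : M} (hx : x ∈ omegaSet M) (hy : y ∈ omegaSet M) :
    x ∈ₘ y ∨ x = y ∨ y ∈ₘ x := by
  refine hM.omega_induction (c := (id : M → M))
    (D := fun x : M => ∀ y : M, y ∈ omegaSet M → x ∈ₘ y ∨ x = y ∨ y ∈ₘ x) ?_ ?_ ?_ x hx y hy
  ·
    repeat'
      first
      | with_reducible apply Unif.and | with_reducible apply Unif.or | with_reducible apply Unif.all
      | with_reducible apply Unif.ex | with_reducible apply Unif.not
      | with_reducible apply Unif.imp | with_reducible apply Unif.iff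
      | apply Unif.mem | apply Unif.eq | exact UTerm.var _
      | apply Unif.memOmegaSet
  · intro e he y hy
    refine hM.omega_induction (c := (id : M → M)) (D := fun y : M => e ∈ₘ y ∨ e = y ∨ y ∈ₘ e) ?_
      (fun e' he' => Or.inr (Or.inl (hM.eq_of_isEmptySet he he'))) (fun n _ ih m hm => ?_) y hy
    ·
      repeat'
        first
        | with_reducible apply Unif.and | with_reducible apply Unif.or
        | with_reducible apply Unif.all
        | with_reducible apply Unif.ex | with_reducible apply Unif.not
        | with_reducible apply Unif.imp | with_reducible apply Unif.iff
        | apply Unif.mem | apply Unif.eq | exact UTerm.var _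
        | exact UTerm.param _
    · rcases ih with h | rfl | h
      · exact Or.inl ((hm _).2 (Or.inl h))
      · exact Or.inl ((hm _).2 (Or.inr rfl))
      · exact absurd h (he _)
  · intro n hn ih m hm y hy
    rcases ih y hy with h | rfl | h
    · rcases hM.succ_le_of_lt hy hm h with h | h
      · exact Or.inl h
      · exact Or.inr (Or.inl h)
    · exact Or.inr (Or.inr ((hm _).2 (Or.inr rfl)))
    · exact Or.inr (Or.inr ((hm _).2 (Or.inl h)))

theorem isIterUnion_zero (hM : IsModelZFGC M) {x e : M} (he : IsEmptySet e) : IsIterUnion x e x := by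
  obtain ⟨p, hp⟩ := hM.exists_pair e x
  obtain ⟨a, ha⟩ := hM.pairing p p
  refine ⟨a, p, fun q hq k y hk => Or.inl ?_, hp, (ha p).2 (Or.inl rfl)⟩
  obtain rfl : q = p := by simpa using (ha q).1 hq
  obtain ⟨rfl, rfl⟩ := hM.pair_inj hp hk
  exact ⟨he, rfl⟩

theorem isIterUnion_succ (hM : IsModelZFGC M) {x n m y z : M} (h : IsIterUnion x n y) (hm : IsSuccOf m n)
    (hz : IsUnionOf z y) : IsIterUnion x m z := by
  obtain ⟨a, p, ha, hp, hpa⟩ := h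
  obtain ⟨q, hq⟩ := hM.exists_pair m z
  obtain ⟨b, hb⟩ := hM.exists_insert a q
  refine ⟨b, q, fun r hr k t hk => ?_, hq, (hb q).2 (Or.inr rfl)⟩
  rcases (hb r).1 hr with hr | rfl
  · rcases ha r hr k t hk with h | ⟨j, w, q', h1, h2, h3, h4⟩
    · exact Or.inl h
    · exact Or.inr ⟨j, w, q', h1, h2, (hb q').2 (Or.inl h3), h4⟩
  · obtain ⟨rfl, rfl⟩ := hM.pair_inj hq hk
    exact Or.inr ⟨n, y, p, hm, hp, (hb p).2 (Or.inl hpa), hz⟩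

/-- Recursion without recursive functions: a derivation only has to justify each of its pairs by
another one and need not be single-valued by definition. Uniqueness comes from the induction,
existence from adding one pair. -/
theorem existsUnique_isIterUnion (hM : IsModelZFGC M) (x : M) {n : M} (hn : n ∈ omegaSet M) :
    ∃ y, ∀ z, IsIterUnion x n z ↔ z = y := by
  refine hM.omega_induction (c := (id : M → M))
    (D := fun n : M => ∃ y, ∀ z, IsIterUnion x n z ↔ z = y) ?_ ?_ ?_ n hn
  ·
    repeat'
      first
      | with_reducible apply Unif.and | with_reducible apply Unif.or | with_reducible apply Unif.all
      | with_reducible apply Unif.ex | with_reducible apply Unif.not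
      | with_reducible apply Unif.imp | with_reducible apply Unif.iff
      | apply Unif.mem | apply Unif.eq | exact UTerm.var _
      | apply Dfn.isIterUnion | exact UTerm.param _
  · intro e he
    refine ⟨x, fun z => ⟨?_, ?_⟩⟩
    · rintro ⟨a, p, ha, hp, hpa⟩
      rcases ha p hpa e z hp with h | ⟨j, w, q, h, -⟩
      · exact h.2
      · exact absurd ((h j).2 (Or.inr rfl)) (he j)
    · rintro rfl
      exact hM.isIterUnion_zero he
  · rintro n hn ⟨y, hy⟩ m hm
    obtain ⟨z, hz⟩ := hM.union y
    refine ⟨z, fun z' => ⟨?_, ?_⟩⟩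
    · rintro ⟨a, p, ha, hp, hpa⟩
      rcases ha p hpa m z' hp with h | ⟨j, w, q, h1, h2, h3, h4⟩
      · exact absurd ((hm n).2 (Or.inr rfl)) (h.1 n)
      · obtain rfl := hM.succ_inj hm h1
        obtain rfl := (hy w).1 ⟨a, q, ha, h2, h3⟩
        exact hM.union_unique h4 hz
    · rintro rfl
      exact hM.isIterUnion_succ ((hy y).2 rfl) hm hz

/-- Every set is contained in a transitive set. -/
theorem exists_isTrans (hM : IsModelZFGC M) (x : M) : ∃ T : M, IsTrans T ∧ Sub x T := by
  obtain ⟨w, hw⟩ := hM.exists_isOmega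
  -- Replacement along `ω` collects all iterated unions of `x`; the transitive set is their union.
  obtain ⟨W, hW⟩ := hM.repl (c := (id : M → M)) (R := fun n y => IsIterUnion x n y)
    (by
        repeat'
          first
          | with_reducible apply Unif.and | with_reducible apply Unif.or
          | with_reducible apply Unif.all
          | with_reducible apply Unif.ex | with_reducible apply Unif.not
          | with_reducible apply Unif.imp | with_reducible apply Unif.iff
          | apply Unif.mem | apply Unif.eq | exact UTerm.var _
          | apply Dfn.isIterUnion | exact UTerm.param _) w (fun n hn => by
      obtain ⟨y, hy⟩ := hM.existsUnique_isIterUnion x ⟨w, hw, hn⟩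
      exact ⟨y, (hy y).2 rfl, fun z hz => (hy z).1 hz⟩)
  obtain ⟨T, hT⟩ := hM.union W
  refine ⟨T, fun y hy z hz => ?_, fun z hz => ?_⟩
  · obtain ⟨u, hu, hyu⟩ := (hT y).1 hy
    obtain ⟨n, hn, hnu⟩ := (hW u).1 hu
    obtain ⟨m, hm, hmw⟩ := hw.1.2 n hn
    obtain ⟨u', hu'⟩ := hM.union u
    exact (hT z).2 ⟨u', (hW u').2 ⟨m, hmw, hM.isIterUnion_succ hnu hm hu'⟩, (hu' z).2 ⟨y, hyu, hz⟩⟩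
  · obtain ⟨e, he, hew⟩ := hw.1.1
    exact (hT z).2 ⟨x, (hW x).2 ⟨e, hew, hM.isIterUnion_zero he⟩, hz⟩

/-- Foundation for definable classes. -/
theorem exists_minimal (hM : IsModelZFGC M) {γ : Type*} {c : γ → M} {D : M → Prop}
    (hD : Dfn c (fun v : Fin 1 → M => D (v 0))) {x : M} (hx : D x) :
    ∃ y, D y ∧ ∀ z, z ∈ₘ y → ¬ D z := by
  -- The axiom of foundation applies to sets only. Inside a transitive `T` a minimal element of `D ∩
  -- T` is minimal in `D`; if the intersection is empty, `x` itself is minimal.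
  obtain ⟨T, hT, hxT⟩ := hM.exists_isTrans x
  obtain ⟨S, hS⟩ := hM.sep hD T
  by_cases h : ∃ y, y ∈ₘ S
  · obtain ⟨y, hy, hy'⟩ := hM.foundation S h
    refine ⟨y, ((hS y).1 hy).2, fun z hz hDz => hy' z ⟨hz, (hS z).2 ⟨?_, hDz⟩⟩⟩
    exact hT y ((hS y).1 hy).1 z hz
  · exact ⟨x, hx, fun z hz hDz => h ⟨z, (hS z).2 ⟨hxT z hz, hDz⟩⟩⟩

end IsModelZFGC

end SetTheory

/-! ### Levels of the cumulative hierarchy and definable choice. -/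

section Levels

variable {M : Type u} [setLang.Structure M]

/-- A history, in the sense of level theory: every member `x` of `h` consists of the subsets of
those members of `x` that belong to `h`. -/
def IsHistory (h : M) : Prop :=
  ∀ x : M, x ∈ₘ h → ∀ y : M, y ∈ₘ x ↔ ∃ r : M, (r ∈ₘ x ∧ r ∈ₘ h) ∧ Sub y r

/-- A level of the cumulative hierarchy. -/
def IsLevel (s : M) : Prop :=
  ∃ h : M, IsHistory h ∧ ∀ y : M, y ∈ₘ s ↔ ∃ r : M, r ∈ₘ h ∧ Sub y r

section Definability

variable {γ α : Type*} {c : γ → M} {s : (α → M) → M}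

theorem Dfn.isHistory (h : UTerm c c s s) : Dfn c (fun v => IsHistory (s v)) := by
  unfold IsHistory
  repeat'
    first
    | with_reducible apply Unif.and | with_reducible apply Unif.or | with_reducible apply Unif.all
    | with_reducible apply Unif.ex | with_reducible apply Unif.not | with_reducible apply Unif.imp
    | with_reducible apply Unif.iff
    | apply Unif.mem | apply Unif.eq | exact UTerm.var _
    | apply Dfn.sub | exact h.weak | exact h.weak.weak.weak

theorem Dfn.isLevel (h : UTerm c c s s) : Dfn c (fun v => IsLevel (s v)) := by
  unfold IsLevel
  repeat'
    first
    | with_reducible apply Unif.and | with_reducible apply Unif.or | with_reducible apply Unif.all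
    | with_reducible apply Unif.ex | with_reducible apply Unif.not | with_reducible apply Unif.imp
    | with_reducible apply Unif.iff
    | apply Unif.mem | apply Unif.eq | exact UTerm.var _
    | apply Dfn.sub | apply Dfn.isHistory | exact h.weak.weak

end Definability

theorem IsLevel.mem_of_sub {s x y : M} (hs : IsLevel s) (hx : x ∈ₘ s) (h : Sub y x) : y ∈ₘ s := by
  obtain ⟨h', -, hs⟩ := hs
  obtain ⟨r, hr, hxr⟩ := (hs x).1 hx
  exact (hs y).2 ⟨r, hr, fun z hz => hxr z (h z hz)⟩

namespace IsModelZFGC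

theorem isTrans_of_mem_history (hM : IsModelZFGC M) {h x : M} (hh : IsHistory h) (hx : x ∈ₘ h) : IsTrans x := by
  by_contra hn
  obtain ⟨S, hS⟩ := hM.sep (c := (id : M → M)) (D := fun x => ¬ IsTrans x) (by
    unfold IsTrans
    repeat'
      first
      | with_reducible apply Unif.and | with_reducible apply Unif.or | with_reducible apply Unif.all
      | with_reducible apply Unif.ex | with_reducible apply Unif.not
      | with_reducible apply Unif.imp | with_reducible apply Unif.iff
      | apply Unif.mem | apply Unif.eq | exact UTerm.var _
      | apply Dfn.sub) h
  obtain ⟨y, hy, hmin⟩ := hM.foundation S ⟨x, (hS x).2 ⟨hx, hn⟩⟩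
  obtain ⟨hyh, hy⟩ := (hS y).1 hy
  refine hy fun z hz t ht => ?_
  obtain ⟨r, ⟨hry, hrh⟩, hzr⟩ := (hh y hyh z).1 hz
  have hr : IsTrans r := by
    by_contra hr
    exact hmin r ⟨hry, (hS r).2 ⟨hrh, hr⟩⟩
  exact (hh y hyh t).2 ⟨r, ⟨hry, hrh⟩, hr t (hzr t ht)⟩

theorem isTrans_of_isLevel (hM : IsModelZFGC M) {s : M} (hs : IsLevel s) : IsTrans s := by
  obtain ⟨h, hh, hs⟩ := hs
  intro y hy z hz
  obtain ⟨r, hr, hyr⟩ := (hs y).1 hy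
  exact (hs z).2 ⟨r, hr, hM.isTrans_of_mem_history hh hr z (hyr z hz)⟩

/-- The history of `x` is `x ∩ h`; the transitivity of `x` ensures that nothing needed is cut off.
-/
theorem isLevel_of_mem_history (hM : IsModelZFGC M) {h x : M} (hh : IsHistory h) (hx : x ∈ₘ h) : IsLevel x := by
  obtain ⟨k, hk⟩ := hM.sep (c := (id : M → M)) (D := fun r => r ∈ₘ h) (by
    repeat'
      first
      | with_reducible apply Unif.and | with_reducible apply Unif.or | with_reducible apply Unif.all
      | with_reducible apply Unif.ex | with_reducible apply Unif.not
      | with_reducible apply Unif.imp | with_reducible apply Unif.iff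
      | apply Unif.mem | apply Unif.eq | exact UTerm.var _
      | exact UTerm.param _) x
  refine ⟨k, fun y hy z => ?_, fun y => ?_⟩
  · obtain ⟨hyx, hyh⟩ := (hk y).1 hy
    refine (hh y hyh z).trans (exists_congr fun r => and_congr_left fun _ => and_congr_right
      fun hry => ⟨fun hrh => (hk r).2 ⟨?_, hrh⟩, fun hrk => ((hk r).1 hrk).2⟩)
    exact hM.isTrans_of_mem_history hh hx y hyx r hry
  · exact (hh x hx y).trans (exists_congr fun r => and_congr_left fun _ => (hk r).symm)

/-- This removes the history from the description: a level is determined by the levels that belong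
to it, so levels can be compared by extensionality. -/
theorem mem_level_iff (hM : IsModelZFGC M) {s : M} (hs : IsLevel s) (y : M) :
    y ∈ₘ s ↔ ∃ r, (IsLevel r ∧ r ∈ₘ s) ∧ Sub y r := by
  constructor
  · intro hy
    obtain ⟨h, hh, hs⟩ := hs
    obtain ⟨r, hr, hyr⟩ := (hs y).1 hy
    exact ⟨r, ⟨hM.isLevel_of_mem_history hh hr, (hs r).2 ⟨r, hr, fun z hz => hz⟩⟩, hyr⟩
  · rintro ⟨r, ⟨-, hr⟩, hyr⟩
    exact hs.mem_of_sub hr hyr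

/-- Take `s` minimal among the levels incomparable with some level, then `t` minimal among those
incomparable with `s`. By minimality and transitivity the same levels belong to both, so they are
equal. -/
theorem level_trichotomy (hM : IsModelZFGC M) {s t : M} (hs : IsLevel s) (ht : IsLevel t) :
    s ∈ₘ t ∨ s = t ∨ t ∈ₘ s := by
  by_contra hn
  obtain ⟨s, ⟨hs, t, ht, hn⟩, hmin⟩ := hM.exists_minimal (c := (id : M → M))
    (D := fun s : M => IsLevel s ∧ ∃ t : M, IsLevel t ∧ ¬ (s ∈ₘ t ∨ s = t ∨ t ∈ₘ s)) (by
      repeat'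
        first
        | with_reducible apply Unif.and | with_reducible apply Unif.or
        | with_reducible apply Unif.all
        | with_reducible apply Unif.ex | with_reducible apply Unif.not
        | with_reducible apply Unif.imp | with_reducible apply Unif.iff
        | apply Unif.mem | apply Unif.eq | exact UTerm.var _
        | apply Dfn.isLevel) (x := s) ⟨hs, t, ht, hn⟩
  obtain ⟨t, ⟨ht, hn⟩, hmin'⟩ := hM.exists_minimal (c := (id : M → M))
    (D := fun t : M => IsLevel t ∧ ¬ (s ∈ₘ t ∨ s = t ∨ t ∈ₘ s)) (by
      repeat'
        first
        | with_reducible apply Unif.and | with_reducible apply Unif.or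
        | with_reducible apply Unif.all
        | with_reducible apply Unif.ex | with_reducible apply Unif.not
        | with_reducible apply Unif.imp | with_reducible apply Unif.iff
        | apply Unif.mem | apply Unif.eq | exact UTerm.var _
        | apply Dfn.isLevel | exact UTerm.param _) (x := t) ⟨ht, hn⟩
  refine hn (Or.inr (Or.inl (hM.extensionality _ _ fun y => ?_)))
  rw [hM.mem_level_iff hs, hM.mem_level_iff ht]
  refine exists_congr fun r => and_congr_left fun _ => and_congr_right fun hr => ⟨fun h => ?_, fun h => ?_⟩
  · by_contra hrt
    refine hmin r h ⟨hr, t, ht, ?_⟩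
    rintro (h' | rfl | h')
    · exact hrt h'
    · exact hn (Or.inr (Or.inr h))
    · exact hn (Or.inr (Or.inr (hM.isTrans_of_isLevel hs r h t h')))
  · by_contra hrs
    refine hmin' r h ⟨hr, ?_⟩
    rintro (h' | rfl | h')
    · exact hn (Or.inl (hM.isTrans_of_isLevel ht r h s h'))
    · exact hn (Or.inl h)
    · exact hrs h'

/-- The levels form a well-ordered class: a definable nonempty class of levels has exactly one
least element. -/
theorem existsUnique_least_level (hM : IsModelZFGC M) {γ : Type*} {c : γ → M} {D : M → Prop}
    (hD : Dfn c (fun v : Fin 1 → M => D (v 0))) {s : M} (hs : IsLevel s) (hx : D s) :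
    ∃ r, ∀ r', (IsLevel r' ∧ D r' ∧ ∀ q, q ∈ₘ r' → ¬ (IsLevel q ∧ D q)) ↔ r' = r := by
  obtain ⟨r, ⟨hr, hDr⟩, hmin⟩ := hM.exists_minimal (D := fun s => IsLevel s ∧ D s)
    ((Dfn.isLevel (UTerm.var _)).and hD) (x := s) ⟨hs, hx⟩
  refine ⟨r, fun r' => ⟨fun ⟨hr', hDr', hmin'⟩ => ?_, ?_⟩⟩
  · rcases hM.level_trichotomy hr hr' with h | h | h
    · exact absurd ⟨hr, hDr⟩ (hmin' r h)
    · exact h.symm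
    · exact absurd ⟨hr', hDr'⟩ (hmin r' h)
  · rintro rfl
    exact ⟨hr, hDr, hmin⟩

/-- A set of levels that contains the levels belonging to its members gives rise to a level. -/
theorem exists_level_of_history (hM : IsModelZFGC M) {h : M} (h1 : ∀ r, r ∈ₘ h → IsLevel r)
    (h2 : ∀ r q, r ∈ₘ h → q ∈ₘ r → IsLevel q → q ∈ₘ h) :
    ∃ s, IsLevel s ∧ ∀ r, r ∈ₘ h → r ∈ₘ s := by
  obtain ⟨U, hU⟩ := hM.union h
  obtain ⟨W, hW⟩ := hM.power U
  obtain ⟨s, hs⟩ := hM.sep (c := (id : M → M)) (D := fun y => ∃ r : M, r ∈ₘ h ∧ Sub y r) (by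
    repeat'
      first
      | with_reducible apply Unif.and | with_reducible apply Unif.or | with_reducible apply Unif.all
      | with_reducible apply Unif.ex | with_reducible apply Unif.not
      | with_reducible apply Unif.imp | with_reducible apply Unif.iff
      | apply Unif.mem | apply Unif.eq | exact UTerm.var _
      | apply Dfn.sub | exact UTerm.param _) W
  have hs' : ∀ y : M, y ∈ₘ s ↔ ∃ r : M, r ∈ₘ h ∧ Sub y r := by
    intro y
    refine (hs y).trans (and_iff_right_of_imp ?_)
    rintro ⟨r, hr, hy⟩
    exact (hW y).2 fun z hz => (hU z).2 ⟨r, hr, hy z hz⟩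
  refine ⟨s, ⟨h, fun x hx y => ?_, hs'⟩, fun r hr => (hs' r).2 ⟨r, hr, fun z hz => hz⟩⟩
  refine (hM.mem_level_iff (h1 x hx) y).trans (exists_congr fun r => and_congr_left fun _ => ?_)
  constructor
  · rintro ⟨hr, hrx⟩
    exact ⟨hrx, h2 x r hx hrx hr⟩
  · rintro ⟨hrx, hrh⟩
    exact ⟨h1 r hrh, hrx⟩

theorem exists_level_mem_of_sub (hM : IsModelZFGC M) {s x : M} (hs : IsLevel s) (hx : Sub x s) :
    ∃ t, IsLevel t ∧ x ∈ₘ t := by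
  obtain ⟨k, hk⟩ := hM.exists_insert s s
  obtain ⟨h, hh⟩ := hM.sep (c := (id : M → M)) (D := IsLevel) (Dfn.isLevel (UTerm.var _)) k
  obtain ⟨t, ht, hht⟩ := hM.exists_level_of_history (h := h) (fun r hr => ((hh r).1 hr).2) (by
    intro r q hr hq hql
    refine (hh q).2 ⟨(hk q).2 (Or.inl ?_), hql⟩
    rcases (hk r).1 ((hh r).1 hr).1 with hr | rfl
    · exact hM.isTrans_of_isLevel hs r hr q hq
    · exact hq)
  exact ⟨t, ht, ht.mem_of_sub (hht s ((hh s).2 ⟨(hk s).2 (Or.inr rfl), hs⟩)) hx⟩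

/-- Every set belongs to a level. -/
theorem exists_level_mem (hM : IsModelZFGC M) (x : M) : ∃ s, IsLevel s ∧ x ∈ₘ s := by
  by_contra hn
  obtain ⟨x, hn, hmin⟩ := hM.exists_minimal (c := (id : M → M))
    (D := fun x : M => ¬ ∃ s : M, IsLevel s ∧ x ∈ₘ s) (by
        repeat'
          first
          | with_reducible apply Unif.and | with_reducible apply Unif.or
          | with_reducible apply Unif.all
          | with_reducible apply Unif.ex | with_reducible apply Unif.not
          | with_reducible apply Unif.imp | with_reducible apply Unif.iff
          | apply Unif.mem | apply Unif.eq | exact UTerm.var _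
          | apply Dfn.isLevel) (x := x) hn
  simp only [not_not] at hmin
  -- Each member of the minimal counterexample `x` contributes the least level containing it; being
  -- unique, these levels can be collected by replacement.
  obtain ⟨R, hR⟩ := hM.repl (c := (id : M → M)) (x := x)
    (R := fun y s : M => IsLevel s ∧ y ∈ₘ s ∧ ∀ q : M, q ∈ₘ s → ¬ (IsLevel q ∧ y ∈ₘ q)) (by
      repeat'
        first
        | with_reducible apply Unif.and | with_reducible apply Unif.or
        | with_reducible apply Unif.all
        | with_reducible apply Unif.ex | with_reducible apply Unif.not
        | with_reducible apply Unif.imp | with_reducible apply Unif.iff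
        | apply Unif.mem | apply Unif.eq | exact UTerm.var _
        | apply Dfn.isLevel) (by
    intro y hy
    obtain ⟨s, hs, hys⟩ := hmin y hy
    obtain ⟨r, hr⟩ := hM.existsUnique_least_level (c := (id : M → M)) (D := fun s => y ∈ₘ s) (by
      repeat'
        first
        | with_reducible apply Unif.and | with_reducible apply Unif.or
        | with_reducible apply Unif.all
        | with_reducible apply Unif.ex | with_reducible apply Unif.not
        | with_reducible apply Unif.imp | with_reducible apply Unif.iff
        | apply Unif.mem | apply Unif.eq | exact UTerm.var _
        | exact UTerm.param _) hs hys
    exact ⟨r, (hr r).2 rfl, fun q hq => (hr q).1 hq⟩)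
  -- Adding the members of members of `R` and keeping only the levels gives a set closed under
  -- passing to smaller levels. The level `t` above it includes `x` as a subset.
  obtain ⟨U, hU⟩ := hM.union R
  obtain ⟨k, hk⟩ := hM.pairing U R
  obtain ⟨V, hV⟩ := hM.union k
  obtain ⟨h, hh⟩ := hM.sep (c := (id : M → M)) (D := IsLevel) (Dfn.isLevel (UTerm.var _)) V
  have hRl : ∀ r, r ∈ₘ R → IsLevel r := by
    intro r hr
    obtain ⟨y, -, hl, -⟩ := (hR r).1 hr
    exact hl
  have hVm : ∀ r, r ∈ₘ V ↔ r ∈ₘ U ∨ r ∈ₘ R := by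
    intro r
    rw [hV]
    constructor
    · rintro ⟨y, hy, hr⟩
      rcases (hk y).1 hy with rfl | rfl
      · exact Or.inl hr
      · exact Or.inr hr
    · rintro (hr | hr)
      · exact ⟨U, (hk U).2 (Or.inl rfl), hr⟩
      · exact ⟨R, (hk R).2 (Or.inr rfl), hr⟩
  obtain ⟨t, ht, hht⟩ := hM.exists_level_of_history (h := h) (fun r hr => ((hh r).1 hr).2) (by
    intro r q hr hq hql
    refine (hh q).2 ⟨(hVm q).2 (Or.inl ?_), hql⟩
    rcases (hVm r).1 ((hh r).1 hr).1 with hr | hr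
    · obtain ⟨s, hs, hrs⟩ := (hU r).1 hr
      exact (hU q).2 ⟨s, hs, hM.isTrans_of_isLevel (hRl s hs) r hrs q hq⟩
    · exact (hU q).2 ⟨r, hr, hq⟩)
  refine hn (hM.exists_level_mem_of_sub ht fun y hy => ?_)
  obtain ⟨s, hs, hys⟩ := hmin y hy
  obtain ⟨r, hr⟩ := hM.existsUnique_least_level (c := (id : M → M)) (D := fun s => y ∈ₘ s) (by
    repeat'
      first
      | with_reducible apply Unif.and | with_reducible apply Unif.or | with_reducible apply Unif.all
      | with_reducible apply Unif.ex | with_reducible apply Unif.not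
      | with_reducible apply Unif.imp | with_reducible apply Unif.iff
      | apply Unif.mem | apply Unif.eq | exact UTerm.var _
      | exact UTerm.param _) hs hys
  have hr' := (hr r).2 rfl
  have hrR : r ∈ₘ R := (hR r).2 ⟨y, hy, hr'⟩
  exact hM.isTrans_of_isLevel ht r (hht r ((hh r).2 ⟨(hVm r).2 (Or.inr hrR), hr'.1⟩)) y hr'.2.1

/-- Definable choice: a nonempty definable class has a definable element. -/
theorem exists_definable_mem (hM : IsModelZFGC M) {γ : Type*} {c : γ → M} {D : M → Prop}
    (hD : Dfn c (fun v : Fin 1 → M => D (v 0))) (hne : ∃ x, D x) :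
    ∃ x, D x ∧ Dfn c (fun v : Fin 1 → M => v 0 = x) := by
  obtain ⟨x, hx⟩ := hne
  obtain ⟨s, hs, hxs⟩ := hM.exists_level_mem x
  have hE : Dfn c (fun v : Fin 1 → M => ∃ y, y ∈ₘ v 0 ∧ D y) := by
    apply Unif.ex
    exact (Unif.mem (UTerm.var _) (UTerm.var _)).and (hD.comp (fun _ => none))
  obtain ⟨r, hr⟩ := hM.existsUnique_least_level (D := fun s => ∃ y, y ∈ₘ s ∧ D y) hE hs
    ⟨x, hxs, hx⟩
  -- `F` chooses from sets only, so the class is replaced by its part inside the least level that it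
  -- meets.
  obtain ⟨b, hb⟩ := hM.sep hD r
  obtain ⟨-, ⟨y, hyr, hy⟩, -⟩ := (hr r).2 rfl
  have hF := hM.globalChoice b ⟨y, (hb y).2 ⟨hyr, hy⟩⟩
  refine ⟨choiceFun b, ((hb _).1 hF).2, ?_⟩
  have key : Dfn c (fun v : Fin 1 → M => ∃ r b : M, (IsLevel r ∧ (∃ y, y ∈ₘ r ∧ D y) ∧
      ∀ q, q ∈ₘ r → ¬ (IsLevel q ∧ ∃ y, y ∈ₘ q ∧ D y)) ∧ (∀ t, t ∈ₘ b ↔ t ∈ₘ r ∧ D t) ∧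
      v 0 = choiceFun b) := by
    repeat'
      first
      | with_reducible apply Unif.and | with_reducible apply Unif.or | with_reducible apply Unif.all
      | with_reducible apply Unif.ex | with_reducible apply Unif.not
      | with_reducible apply Unif.imp | with_reducible apply Unif.iff
      | apply Unif.mem | apply Unif.eq | exact UTerm.var _
      | apply Dfn.isLevel | exact (UTerm.var _).choice | exact hD.comp (fun _ => none)
  refine key.congr ?_ ?_ <;>
  · intro v
    constructor
    · intro h
      exact ⟨r, b, (hr r).2 rfl, hb, h⟩
    · rintro ⟨r', b', h1, h2, h3⟩
      obtain rfl := (hr r').1 h1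
      rw [h3, hM.extensionality b' b fun t => (h2 t).trans (hb t).symm]

end IsModelZFGC

end Levels

/-! ### Bounds, Skolem functions and the definable closure. -/

section Arithmetic

variable {M : Type u} [setLang.Structure M]

namespace IsModelZFGC

theorem omega_lt_trans (hM : IsModelZFGC M) {x y z : M} (hz : z ∈ omegaSet M) (hxy : x ∈ₘ y) (hyz : y ∈ₘ z) : x ∈ₘ z :=
  hM.isTrans_of_mem_omega hz y hyz x hxy

/-- The least element of a definable class of natural numbers. -/
theorem existsUnique_least_omega (hM : IsModelZFGC M) {γ : Type*} {c : γ → M} {D : M → Prop}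
    (hD : Dfn c (fun v : Fin 1 → M => D (v 0))) {x : M} (hx : x ∈ omegaSet M) (hDx : D x) :
    ∃ r, ∀ r', (r' ∈ omegaSet M ∧ D r' ∧ ∀ q, q ∈ₘ r' → ¬ D q) ↔ r' = r := by
  obtain ⟨r, ⟨hr, hDr⟩, hmin⟩ := hM.exists_minimal (D := fun x => x ∈ omegaSet M ∧ D x)
    ((Unif.memOmegaSet (UTerm.var _)).and hD) (x := x) ⟨hx, hDx⟩
  refine ⟨r, fun r' => ⟨fun ⟨hr', hDr', hmin'⟩ => ?_, ?_⟩⟩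
  · rcases hM.omega_trichotomy hr hr' with h | h | h
    · exact absurd hDr (hmin' r h)
    · exact h.symm
    · exact absurd ⟨hr', hDr'⟩ (hmin r' h)
  · rintro rfl
    exact ⟨hr, hDr, fun q hq hDq => hmin q hq ⟨hM.omega_trans hr hq, hDq⟩⟩

theorem exists_max (hM : IsModelZFGC M) {a b : M} (ha : a ∈ omegaSet M) (hb : b ∈ omegaSet M) :
    ∃ m ∈ omegaSet M, ∀ z, z ∈ₘ a ∨ z ∈ₘ b → z ∈ₘ m := by
  rcases hM.omega_trichotomy ha hb with h | rfl | h
  · exact ⟨b, hb, fun z hz => hz.elim (fun hz => hM.omega_lt_trans hb hz h) id⟩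
  · exact ⟨a, ha, fun z hz => hz.elim id id⟩
  · exact ⟨a, ha, fun z hz => hz.elim id (fun hz => hM.omega_lt_trans ha hz h)⟩

theorem exists_lt_of_finite (hM : IsModelZFGC M) {ι : Type*} [Finite ι] {z : ι → M} (hz : ∀ i, z i ∈ omegaSet M) :
    ∃ m ∈ omegaSet M, ∀ i, z i ∈ₘ m := by
  classical
  have := Fintype.ofFinite ι
  suffices h : ∀ s : Finset ι, ∃ m ∈ omegaSet M, ∀ i ∈ s, z i ∈ₘ m by
    obtain ⟨m, hm, h⟩ := h Finset.univ
    exact ⟨m, hm, fun i => h i (Finset.mem_univ i)⟩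
  intro s
  induction s using Finset.induction_on with
  | empty =>
    obtain ⟨e, he⟩ := hM.exists_empty
    exact ⟨e, hM.zero_mem he, by simp⟩
  | insert j s _ ih =>
    obtain ⟨m, hm, h⟩ := ih
    obtain ⟨k, hk⟩ := hM.exists_succ (z j)
    obtain ⟨m', hm', h'⟩ := hM.exists_max hm (hM.succ_mem (hz j) hk)
    refine ⟨m', hm', fun i hi => ?_⟩
    rcases Finset.mem_insert.1 hi with rfl | hi
    · exact h' _ (Or.inr ((hk _).2 (Or.inr rfl)))
    · exact h' _ (Or.inl (h i hi))

/-- A definable partial function takes bounded values at the tuples of numbers below `x`. -/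
theorem exists_bound (hM : IsModelZFGC M) {n : ℕ} {P : (Fin n → M) → M → Prop}
    (hP : Dfn (id : M → M) (fun w : Option (Fin n) → M => P (fun i => w (some i)) (w none)))
    (hf : ∀ y z z', P y z → P y z' → z = z') {x : M} (hx : x ∈ omegaSet M) :
    ∃ b ∈ omegaSet M, ∀ y : Fin n → M, (∀ i, y i ∈ₘ x) → ∀ z, z ∈ omegaSet M → P y z → z ∈ₘ b := by
  induction n with
  | zero =>
    by_cases h : ∃ z ∈ omegaSet M, P ![] z
    · obtain ⟨z, hz, hPz⟩ := h
      obtain ⟨b, hb⟩ := hM.exists_succ z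
      refine ⟨b, hM.succ_mem hz hb, fun y _ z' _ h => (hb z').2 (Or.inr ?_)⟩
      rw [Subsingleton.elim y (![] : Fin 0 → M)] at h
      exact hf _ _ _ h hPz
    · refine ⟨x, hx, fun y _ z' hz' h' => absurd ⟨z', hz', ?_⟩ h⟩
      rwa [Subsingleton.elim y (![] : Fin 0 → M)] at h'
  | succ n ih =>
    -- An induction inside the model on a separate bound `k` for the first coordinate. Its successor
    -- step adds the single value `k` of that coordinate, which is frozen as a parameter so that the
    -- case of `n` variables applies.
    suffices h : ∀ k ∈ omegaSet M, ∃ b, b ∈ omegaSet M ∧ ∀ y : Fin (n + 1) → M,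
        (y 0 ∈ₘ k ∧ ∀ i, y i ∈ₘ x) → ∀ z, z ∈ omegaSet M → P y z → z ∈ₘ b by
      obtain ⟨b, hb, h⟩ := h x hx
      exact ⟨b, hb, fun y hy => h y ⟨hy 0, hy⟩⟩
    refine hM.omega_induction (c := (id : M → M)) (D := fun k => ∃ b, b ∈ omegaSet M ∧
      ∀ y : Fin (n + 1) → M, (y 0 ∈ₘ k ∧ ∀ i, y i ∈ₘ x) →
        ∀ z, z ∈ omegaSet M → P y z → z ∈ₘ b) ?_ ?_ ?_
    · apply Unif.ex
      refine (Unif.memOmegaSet (UTerm.var _)).and (Unif.allTuple (Unif.imp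
        ((Unif.mem (UTerm.var _) (UTerm.var _)).and (Unif.iAnd fun i => Unif.mem (UTerm.var _)
          (UTerm.param (c := (id : M → M)) (d := (id : M → M)) x))) (Unif.all (Unif.imp (Unif.memOmegaSet (UTerm.var _))
          (Unif.imp ?_ (Unif.mem (UTerm.var _) (UTerm.var _)))))))
      exact hP.comp (fun o => o.elim none (fun i => some (Sum.inr i)))
    · exact fun e he => ⟨x, hx, fun y hy => absurd hy.1 (he _)⟩
    · rintro k hk ⟨b, hb, h⟩ m hm
      obtain ⟨b', hb', h'⟩ := ih (P := fun y z => P (Fin.cons k y) z) (by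
        refine (hP.inst (β := Option (Fin n)) (fun o => o.elim (Sum.inr none)
          (Fin.cases (Sum.inl k) (fun i => Sum.inr (some i))))).congr ?_ ?_ <;>
        · intro w
          refine iff_of_eq (congrArg₂ P ?_ rfl)
          funext i
          refine Fin.cases ?_ (fun i => ?_) i <;> rfl) (fun y => hf _)
      obtain ⟨b'', hb'', h''⟩ := hM.exists_max hb hb'
      refine ⟨b'', hb'', fun y hy z hz hPz => h'' z ?_⟩
      rcases (hm _).1 hy.1 with h0 | h0
      · exact Or.inl (h y ⟨h0, hy.2⟩ z hz hPz)
      · refine Or.inr (h' (Fin.tail y) (fun i => hy.2 i.succ) z hz ?_)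
        rwa [← h0, Fin.cons_self_tail]

/-- A definable partial function extends to a Skolem function. -/
theorem exists_skolemFunction (hM : IsModelZFGC M) {A : Set M} {n : ℕ} {P : (Fin n → M) → M → Prop}
    (hP : Dfn (Subtype.val : A → M)
      (fun w : Option (Fin n) → M => P (fun i => w (some i)) (w none)))
    (hf : ∀ y z z', P y z → P y z' → z = z') :
    ∃ t : (Fin n → M) → M, IsSkolemFunction A t ∧ ∀ y z, P y z → t y = z := by
  classical
  obtain ⟨e, he⟩ := hM.exists_empty
  -- The default value is the empty set, which is definable without parameters.
  let t : (Fin n → M) → M := fun y => if h : ∃ z, P y z then h.choose else e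
  have ht : ∀ y z, P y z → t y = z := by
    intro y z hz
    have h : ∃ z, P y z := ⟨z, hz⟩
    simp only [t, dif_pos h]
    exact hf y _ _ h.choose_spec hz
  refine ⟨t, (dfn_iff_definable (P := fun x : Fin (n + 1) → M => x 0 = t (Fin.tail x))
    Subtype.range_coe).1 ?_, ht⟩
  have key : Dfn (Subtype.val : A → M) (fun x : Fin (n + 1) → M => P (Fin.tail x) (x 0) ∨
      (¬ (∃ z, P (Fin.tail x) z)) ∧ IsEmptySet (x 0)) := by
    refine Unif.or ?_ (Unif.and (Unif.not (Unif.ex ?_)) (Dfn.isEmptySet (UTerm.var _)))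
    · exact hP.comp (fun o => o.elim 0 Fin.succ)
    · exact hP.comp (fun o => o.elim none (fun i => some i.succ))
  refine key.congr ?_ ?_ <;>
  · intro x
    constructor
    · intro h
      by_cases hx : ∃ z, P (Fin.tail x) z
      · obtain ⟨z, hz⟩ := hx
        rw [h, ht _ _ hz]
        exact Or.inl hz
      · refine Or.inr ⟨hx, ?_⟩
        rw [h]
        simpa only [t, dif_neg hx] using he
    · rintro (h | ⟨h, h'⟩)
      · exact (ht _ _ h).symm
      · simp only [t, dif_neg h]
        exact hM.eq_of_isEmptySet h' he

end IsModelZFGC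

/-- The definable closure of `A`. -/
def dcl (A : Set M) : Set M := {b | Dfn (Subtype.val : A → M) (fun v : Fin 1 → M => v 0 = b)}

theorem subset_dcl (A : Set M) : A ⊆ dcl A := fun a ha =>
  Unif.eq (UTerm.var _) (UTerm.param (c := (Subtype.val : A → M)) (d := Subtype.val) ⟨a, ha⟩)

/-- Transitivity of definability: parameters in the closure are quantified away by their own
definitions over `A`. -/
theorem Dfn.of_dcl {A : Set M} {γ α : Type*} {e : γ → M} {P : (α → M) → Prop}
    (hP : Dfn e P) (he : ∀ i, e i ∈ dcl A) : Dfn (Subtype.val : A → M) P := by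
  obtain ⟨k, g, φ, hφ⟩ := hP.exists_finite_params
  have key : Dfn (Subtype.val : A → M) (fun v : α → M => ∃ y : Fin k → M, (∀ i, y i = e (g i)) ∧
      φ.Realize (Sum.elim y v)) := by
    apply Unif.exTuple
    refine (Unif.iAnd fun i => ?_).and ?_
    · exact Unif.comp (he (g i)) (fun _ => Sum.inr i)
    · exact Unif.formula φ Sum.inr Sum.inl
  refine key.congr ?_ ?_ <;>
  · intro v
    rw [hφ]
    constructor
    · exact fun h => ⟨_, fun i => rfl, h⟩
    · rintro ⟨y, hy, h⟩
      rwa [← funext hy]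

theorem choiceFun_mem_dcl {A : Set M} {b : M} (hb : b ∈ dcl A) : choiceFun b ∈ dcl A := by
  have key : Dfn (Subtype.val : A → M) (fun v : Fin 1 → M => ∃ y, y = b ∧ v 0 = choiceFun y) := by
    apply Unif.ex
    exact Unif.and (Unif.comp hb (fun _ => none)) (Unif.eq (UTerm.var _) (UTerm.var _).choice)
  refine key.congr ?_ ?_ <;> simp

namespace IsModelZFGC

/-- A formula defining `b` from a finite tuple gives the partial function "the unique solution",
which extends to a Skolem function without parameters. -/
theorem skolemHull_eq_dcl (hM : IsModelZFGC M) (A : Set M) : skolemHull A = dcl A := by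
  ext b
  constructor
  · rintro ⟨n, t, x, ht, hx, rfl⟩
    have h1 : Dfn (Subtype.val : (∅ : Set M) → M)
        (fun v : Fin (n + 1) → M => v 0 = t (Fin.tail v)) :=
      (dfn_iff_definable Subtype.range_coe).2 ht
    have h2 : Dfn (Subtype.val : A → M) (fun v : Fin (n + 1) → M => v 0 = t (Fin.tail v)) :=
      h1.rebase (fun i => i.2.elim) (fun i => i.2.elim) (fun i => i.2.elim)
    exact h2.inst (β := Fin 1)
      (fun i => Fin.cases (motive := fun _ => A ⊕ Fin 1) (Sum.inr 0) (fun i => Sum.inl ⟨x i, hx i⟩) i)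
  · intro hb
    obtain ⟨k, g, φ, hφ⟩ := Dfn.exists_finite_params hb
    obtain ⟨t, ht, ht'⟩ := hM.exists_skolemFunction (A := ∅) (n := k)
      (P := fun y z => φ.Realize (Sum.elim y (fun _ => z)) ∧
        ∀ z', φ.Realize (Sum.elim y (fun _ => z')) → z' = z)
      (by
        refine Unif.and (Unif.formula φ some (fun _ => none)) (Unif.all (Unif.imp ?_
          (Unif.eq (UTerm.var _) (UTerm.var _))))
        exact Unif.formula φ (fun i => some (some i)) (fun _ => none))
      (fun y z z' h h' => h'.2 z h.1)
    refine ⟨k, t, fun i => g i, ht, fun i => (g i).2, ht' _ _ ⟨?_, fun z' h => ?_⟩⟩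
    · exact (hφ (fun _ => b)).1 rfl
    · exact (hφ (fun _ => z')).2 h

/-- The definable closure, as an elementary substructure. -/
def hull (hM : IsModelZFGC M) (A : Set M) : setLang.ElementarySubstructure M where
  toSubstructure :=
    { carrier := dcl A
      fun_mem := fun {n} F x hx => by
        cases F
        have := choiceFun_mem_dcl (hx 0)
        rwa [choiceFun, show ![x 0] = x from funext fun i => by rw [Subsingleton.elim i 0]; rfl] at this }
  isElementary' := by
    -- Tarski–Vaught test: the solutions form a nonempty class definable over the closure, and
    -- definable choice finds one in the closure.
    refine Substructure.isElementary_of_exists _ fun n φ x a ha => ?_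
    have hD : Dfn (fun i => (x i : M)) (fun v : Fin 1 → M =>
        φ.Realize default (Fin.snoc (fun i => (x i : M)) (v 0) : Fin (n + 1) → M)) := by
      refine dfn_iff.2 ⟨φ.toFormula.relabel (Sum.elim Empty.elim
        (Fin.lastCases (Sum.inr 0) (fun i => Sum.inl i))), fun v => ?_⟩
      rw [Formula.realize_relabel, BoundedFormula.realize_toFormula]
      refine iff_of_eq (congrArg₂ _ (Subsingleton.elim _ _) ?_)
      funext i
      refine Fin.lastCases ?_ (fun i => ?_) i <;> simp
    obtain ⟨b, hb, hb'⟩ := hM.exists_definable_mem (D := fun z =>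
      φ.Realize default (Fin.snoc (fun i => (x i : M)) z : Fin (n + 1) → M)) hD ⟨a, ha⟩
    exact ⟨⟨b, Dfn.of_dcl hb' fun i => (x i).2⟩, hb⟩

end IsModelZFGC

end Arithmetic

/-! ### Realizing `p` and homogeneity of increasing tuples. -/

section Types

variable {M : Type u} {N : Type v} [setLang.Structure N]

theorem holds_varMemParam (f : M → N) (m : M) (a : N) :
    Holds f (varMemParam m) ![a] ↔ a ∈ₘ f m := by
  simp [Holds, varMemParam, Formula.realize_rel₂, Mem]

theorem holds_paramMemVar (f : M → N) (m : M) (a : N) :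
    Holds f (paramMemVar m) ![a] ↔ f m ∈ₘ a := by
  simp [Holds, paramMemVar, Formula.realize_rel₂, Mem]

theorem realize_relabel_param {γ : Type*} (φ : ParamFormula M 1) (i : γ) (e : M ⊕ γ → N) :
    (φ.relabel (Sum.map id (fun _ => i))).Realize e ↔
      Holds (fun m => e (Sum.inl m)) φ ![e (Sum.inr i)] := by
  rw [Formula.realize_relabel]
  refine iff_of_eq (congrArg _ ?_)
  funext j
  rcases j with j | j
  · rfl
  · rw [Subsingleton.elim j 0]; rfl

/-- `a` is a natural number satisfying the formulas in `s`. -/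
def Sat (f : M → N) (s : Finset (ParamFormula M 1)) (a : N) : Prop :=
  a ∈ omegaSet N ∧ ∀ φ ∈ s, Holds f φ ![a]

/-- `a` is an increasing tuple of natural numbers satisfying the formulas in `s`. -/
def IncrSat (f : M → N) (s : Finset (ParamFormula M 1)) {ι : Type*} [LT ι] (a : ι → N) : Prop :=
  (∀ i, Sat f s (a i)) ∧ ∀ i j, i < j → a i ∈ₘ a j

theorem Sat.mono {f : M → N} {s t : Finset (ParamFormula M 1)} (h : s ⊆ t) {a : N}
    (ha : Sat f t a) : Sat f s a := ⟨ha.1, fun φ hφ => ha.2 φ (h hφ)⟩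

theorem IncrSat.mono {f : M → N} {s t : Finset (ParamFormula M 1)} (h : s ⊆ t) {ι : Type*} [LT ι]
    {a : ι → N} (ha : IncrSat f t a) : IncrSat f s a := ⟨fun i => (ha.1 i).mono h, ha.2⟩

theorem Dfn.sat (f : M → N) (s : Finset (ParamFormula M 1)) {α : Type*} (i : α) :
    Dfn f (fun v : α → N => Sat f s (v i)) := by
  refine (Unif.memOmegaSet (UTerm.var i)).and ?_
  refine (Unif.iAnd (P := fun (φ : s) (v : α → N) => φ.1.Realize (Sum.elim f (fun _ => v i)))
    fun φ => Unif.formulaParam φ.1 (fun _ => i)).congr ?_ ?_ <;>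
  · intro v
    have : ![v i] = (fun _ => v i) := funext fun j => by rw [Subsingleton.elim j 0]; rfl
    simp only [Holds, this, Subtype.forall]

theorem Dfn.incrSat (f : M → N) (s : Finset (ParamFormula M 1)) {α ι : Type*} [LinearOrder ι]
    [Finite ι] (g : ι → α) : Dfn f (fun v : α → N => IncrSat f s (fun i => v (g i))) := by
  refine (Unif.iAnd fun i => Dfn.sat f s (g i)).and (Unif.iAnd fun i => Unif.iAnd fun j => ?_)
  by_cases hij : i < j
  · exact (Unif.mem (UTerm.var (g i)) (UTerm.var (g j))).congr (fun v => by simp [hij])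
      (fun v => by simp [hij])
  · exact (Unif.eq (UTerm.var (g i)) (UTerm.var (g i))).congr (fun v => by simp [hij])
      (fun v => by simp [hij])

variable [setLang.Structure M]

theorem mem_omegaSet_map_iff (f : M ↪ₑ[setLang] N) (m : M) :
    f m ∈ omegaSet N ↔ m ∈ omegaSet M :=
  Unif.transfer (c := (id : M → M)) (Unif.memOmegaSet (UTerm.var 0)) (fun _ : Fin 1 => m)

theorem isOmega_map (f : M ↪ₑ[setLang] N) {m : M} (h : IsOmega m) : IsOmega (f m) :=
  (Unif.transfer (c := (id : M → M)) (Unif.isOmega (UTerm.var 0)) (fun _ : Fin 1 => m)).2 h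

theorem mem_map_iff (f : M ↪ₑ[setLang] N) (m m' : M) : f m ∈ₘ f m' ↔ m ∈ₘ m' :=
  Unif.transfer (c := (id : M → M)) (Unif.mem (UTerm.var 0) (UTerm.var 1)) ![m, m']

theorem holds_map_iff (f : M ↪ₑ[setLang] N) {n : ℕ} (φ : ParamFormula M n) (a : Fin n → M) :
    Holds f φ (fun i => f (a i)) ↔ Holds id φ a :=
  Unif.transfer (c := (id : M → M)) (Unif.formulaParam φ id) a

/-- The defining formula has a solution in `N`, hence one in `M`, and the image of the latter must
be `r`. -/
theorem mem_range_of_dfn (f : M ↪ₑ[setLang] N) {r : N} (h : Dfn f (fun v : Fin 1 → N => v 0 = r)) :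
    ∃ m, f m = r := by
  obtain ⟨φ, hφ⟩ := dfn_iff.1 h
  have key : Unif (id : M → M) (fun m => f (id m))
      (fun _ : Fin 0 → M => ∃ x, φ.Realize (Sum.elim id (fun _ => x)))
      (fun _ : Fin 0 → N => ∃ x, φ.Realize (Sum.elim f (fun _ => x))) := by
    apply Unif.ex
    exact Unif.formulaParam φ (fun _ => none)
  obtain ⟨m, hm⟩ := (key.transfer Fin.elim0).1 ⟨r, (hφ fun _ => r).1 rfl⟩
  exact ⟨m, (hφ (fun _ => f m)).2 ((holds_map_iff f φ (fun _ => m)).2 hm)⟩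

/-- An elementary embedding from a map preserving the truth of formulas. -/
def elementaryEmbeddingOfDiagram (f : M → N)
    (h : ∀ ψ : setLang.Formula M, ψ.Realize id → ψ.Realize f) : M ↪ₑ[setLang] N where
  toFun := f
  map_formula' n φ x := by
    have h1 := h (φ.relabel x)
    have h2 := h (φ.not.relabel x)
    simp only [Formula.realize_relabel, Formula.realize_not, Function.id_comp] at h1 h2
    exact ⟨fun h => by_contra fun h' => h2 h' h, h1⟩

variable {p : Set (ParamFormula M 1)}

theorem sat_of_realizes {f : M ↪ₑ[setLang] N} (hp : IsOmegaMinimal p) {a : N} (ha : Realizes f p a)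
    {s : Finset (ParamFormula M 1)} (hs : ↑s ⊆ p) : Sat f s a := by
  obtain ⟨w, hw, hwp⟩ := hp.omegaType.2
  exact ⟨⟨f w, isOmega_map f hw, (holds_varMemParam f w a).1 (ha _ hwp)⟩, fun φ hφ => ha φ (hs hφ)⟩

theorem exists_sat_above (hp : IsOmegaMinimal p) {s : Finset (ParamFormula M 1)} (hs : ↑s ⊆ p)
    {t : Finset M} (ht : ∀ m ∈ t, m ∈ omegaSet M) :
    ∃ a : M, Sat id s a ∧ ∀ m ∈ t, m ∈ₘ a := by
  classical
  obtain ⟨w, hw, hwp⟩ := hp.omegaType.2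
  obtain ⟨a, ha⟩ := hp.omegaType.1 (insert (varMemParam w) (s ∪ t.image paramMemVar)) (by
    intro φ hφ
    simp only [Finset.coe_insert, Finset.coe_union, Finset.coe_image, Set.mem_insert_iff,
      Set.mem_union, Set.mem_image, Finset.mem_coe] at hφ
    rcases hφ with rfl | hφ | ⟨m, hm, rfl⟩
    · exact hwp
    · exact hs hφ
    · exact hp.unbounded m (ht m hm))
  refine ⟨a, ⟨⟨w, hw, (holds_varMemParam id w a).1 (ha _ (Finset.mem_insert_self _ _))⟩,
    fun φ hφ => ha φ (Finset.mem_insert_of_mem (Finset.mem_union_left _ hφ))⟩, fun m hm => ?_⟩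
  exact (holds_paramMemVar id m a).1 (ha _ (Finset.mem_insert_of_mem
    (Finset.mem_union_right _ (Finset.mem_image_of_mem _ hm))))

/-- The indices in `J` are handled in increasing order, so each new element only has to exceed
finitely many numbers of `M`. -/
theorem exists_incr_sat (hp : IsOmegaMinimal p) {I : Type w} [LinearOrder I]
    {s : Finset (ParamFormula M 1)} (hs : ↑s ⊆ p) (J : Finset I) :
    ∃ e : I → M, (∀ i ∈ J, Sat id s (e i)) ∧ ∀ i ∈ J, ∀ j ∈ J, i < j → e i ∈ₘ e j := by
  classical
  induction J using Finset.induction_on_max with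
  | empty =>
    obtain ⟨w, -, -⟩ := hp.omegaType.2
    exact ⟨fun _ => w, by simp, by simp⟩
  | insert j J hj ih =>
    obtain ⟨e, h1, h2⟩ := ih
    obtain ⟨a, ha, ha'⟩ := exists_sat_above hp hs (t := J.image e) (by
      intro m hm
      obtain ⟨i, hi, rfl⟩ := Finset.mem_image.1 hm
      exact (h1 i hi).1)
    have hne : ∀ i ∈ J, i ≠ j := fun i hi => (hj i hi).ne
    refine ⟨Function.update e j a, fun i hi => ?_, fun i hi k hk hik => ?_⟩
    · rcases Finset.mem_insert.1 hi with rfl | hi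
      · simpa using ha
      · simpa [Function.update_of_ne (hne i hi)] using h1 i hi
    · rcases Finset.mem_insert.1 hk with rfl | hk
      · have hi := (Finset.mem_insert.1 hi).resolve_left hik.ne
        simpa [Function.update_of_ne (hne i hi)] using ha' _ (Finset.mem_image_of_mem _ hi)
      · have hi : i ∈ J := (Finset.mem_insert.1 hi).resolve_left
          (hik.trans (hj k hk)).ne
        simpa [Function.update_of_ne (hne i hi), Function.update_of_ne (hne k hk)]
          using h2 i hi k hk hik

/-- An elementary extension with an increasing family of realizations of `p` of order type `I`. -/
theorem exists_extension_realizing (hp : IsOmegaMinimal p) (I : Type w) [LinearOrder I] :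
    ∃ (K : Type (max u w)) (_ : setLang.Structure K) (f : M ↪ₑ[setLang] K) (α : I → K),
      (∀ i, Realizes f p (α i)) ∧ ∀ i j, i < j → α i ∈ₘ α j := by
  classical
  let Good : {s : Finset (ParamFormula M 1) // ↑s ⊆ p} × Finset I → (I → M) → Prop := fun x e =>
    (∀ i ∈ x.2, Sat id x.1.1 (e i)) ∧ ∀ i ∈ x.2, ∀ j ∈ x.2, i < j → e i ∈ₘ e j
  -- `Φ x` is everything true of all good assignments rather than a list of axioms. A larger `x` has
  -- fewer good assignments and so more formulas, which makes the family directed; one good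
  -- assignment in `M` satisfies `Φ x`.
  let Φ : {s : Finset (ParamFormula M 1) // ↑s ⊆ p} × Finset I → Set (setLang.Formula (M ⊕ I)) :=
    fun x => {ψ | ∀ e, Good x e → ψ.Realize (Sum.elim id e)}
  have hne : Nonempty ({s : Finset (ParamFormula M 1) // ↑s ⊆ p} × Finset I) :=
    ⟨⟨∅, by simp⟩, ∅⟩
  obtain ⟨K, _, e, he⟩ := exists_realize_iUnion (Φ := Φ) (by
    rintro ⟨⟨s, hs⟩, J⟩ ⟨⟨t, ht⟩, J'⟩
    refine ⟨⟨⟨s ∪ t, by simpa using ⟨hs, ht⟩⟩, J ∪ J'⟩, fun ψ hψ e h => hψ e ⟨fun i hi => ?_,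
      fun i hi j hj => ?_⟩, fun ψ hψ e h => hψ e ⟨fun i hi => ?_, fun i hi j hj => ?_⟩⟩
    · exact (h.1 i (Finset.mem_union_left _ hi)).mono Finset.subset_union_left
    · exact h.2 i (Finset.mem_union_left _ hi) j (Finset.mem_union_left _ hj)
    · exact (h.1 i (Finset.mem_union_right _ hi)).mono Finset.subset_union_right
    · exact h.2 i (Finset.mem_union_right _ hi) j (Finset.mem_union_right _ hj)) (by
    rintro ⟨⟨s, hs⟩, J⟩
    obtain ⟨e, h⟩ := exists_incr_sat hp hs J
    obtain ⟨w, -, -⟩ := hp.omegaType.2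
    exact ⟨M, inferInstance, ⟨w⟩, Sum.elim id e, fun ψ hψ => hψ e h⟩)
  refine ⟨K, inferInstance, elementaryEmbeddingOfDiagram (fun m => e (Sum.inl m)) ?_,
    fun i => e (Sum.inr i), ?_, ?_⟩
  · intro ψ hψ
    have := he hne.some (ψ.relabel Sum.inl) (fun e' _ => by
      rwa [Formula.realize_relabel])
    rwa [Formula.realize_relabel] at this
  · intro i φ hφ
    have := he ⟨⟨{φ}, by simpa using hφ⟩, {i}⟩ (φ.relabel (Sum.map id (fun _ => i))) (by
      intro e' h
      exact (realize_relabel_param φ i _).2 ((h.1 i (by simp)).2 φ (by simp)))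
    exact (realize_relabel_param φ i e).1 this
  · intro i j hij
    have := he ⟨⟨∅, by simp⟩, {i, j}⟩ (memSym.formula₂ (Term.var (Sum.inr i)) (Term.var (Sum.inr j))) (by
      intro e' h
      have := h.2 i (by simp) j (by simp) hij
      simpa [Formula.realize_rel₂, Mem] using this)
    simpa [Formula.realize_rel₂, Mem] using this

/-- Every definable property of increasing tuples is decided by a finite part of `p`. -/
theorem exists_homogeneous (hp : IsOmegaMinimal p) (f : M ↪ₑ[setLang] N) {n : ℕ}
    {Q : (Fin n → N) → Prop} (hQ : Dfn f Q) :
    ∃ s : Finset (ParamFormula M 1), ↑s ⊆ p ∧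
      ((∀ a, IncrSat f s a → Q a) ∨ ∀ a, IncrSat f s a → ¬ Q a) := by
  classical
  by_contra! hn
  obtain ⟨φ, hφ⟩ := dfn_iff.1 hQ
  let Good : Finset (ParamFormula M 1) → (Fin n → N) → (Fin n → N) → Prop := fun s a b =>
    IncrSat f s a ∧ IncrSat f s b ∧ Q a ∧ ¬ Q b
  let Φ : {s : Finset (ParamFormula M 1) // ↑s ⊆ p} → Set (setLang.Formula (M ⊕ (Fin n ⊕ Fin n))) :=
    fun s => {ψ | ∀ a b, Good s.1 a b → ψ.Realize (Sum.elim f (Sum.elim a b))}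
  have hne : Nonempty {s : Finset (ParamFormula M 1) // ↑s ⊆ p} := ⟨⟨∅, by simp⟩⟩
  -- If no finite part of `p` decides `Q`, compactness yields two increasing tuples of realizations
  -- of `p` that disagree on the formula. The model `K` lies in the universe of `M`, whatever that
  -- of `N`, so the indiscernibility hypothesis applies to it.
  obtain ⟨K, _, e, he⟩ := exists_realize_iUnion (Φ := Φ) (by
    rintro ⟨s, hs⟩ ⟨t, ht⟩
    refine ⟨⟨s ∪ t, by simpa using ⟨hs, ht⟩⟩, fun ψ hψ a b h => hψ a b ⟨?_, ?_, h.2.2⟩,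
      fun ψ hψ a b h => hψ a b ⟨?_, ?_, h.2.2⟩⟩
    · exact h.1.mono Finset.subset_union_left
    · exact h.2.1.mono Finset.subset_union_left
    · exact h.1.mono Finset.subset_union_right
    · exact h.2.1.mono Finset.subset_union_right) (by
    rintro ⟨s, hs⟩
    obtain ⟨⟨b, hb, hb'⟩, a, ha, ha'⟩ := hn s hs
    obtain ⟨w, -, -⟩ := hp.omegaType.2
    exact ⟨N, inferInstance, ⟨f w⟩, _, fun ψ hψ => hψ a b ⟨ha, hb, ha', hb'⟩⟩)
  let g : M ↪ₑ[setLang] K := elementaryEmbeddingOfDiagram (fun m => e (Sum.inl m)) (by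
    intro ψ hψ
    have := he hne.some (ψ.relabel Sum.inl) (fun a b _ => by
      rw [Formula.realize_relabel]
      exact (f.map_formula ψ id).2 hψ)
    rwa [Formula.realize_relabel] at this)
  have hreal : ∀ j, Realizes g p (e (Sum.inr j)) := by
    intro j φ hφ
    have := he ⟨{φ}, by simpa using hφ⟩ (φ.relabel (Sum.map id (fun _ => j))) (by
      intro a b h
      refine (realize_relabel_param φ j _).2 ?_
      rcases j with j | j
      · exact (h.1.1 j).2 φ (by simp)
      · exact (h.2.1.1 j).2 φ (by simp))
    exact (realize_relabel_param φ j e).1 this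
  have hmem : ∀ j k, (∀ s a b, Good s a b → Sum.elim a b j ∈ₘ Sum.elim a b k) →
      e (Sum.inr j) ∈ₘ e (Sum.inr k) := by
    intro j k h
    have := he hne.some (memSym.formula₂ (Term.var (Sum.inr j)) (Term.var (Sum.inr k))) (by
      intro a b hab
      simpa [Formula.realize_rel₂, Mem] using h _ a b hab)
    simpa [Formula.realize_rel₂, Mem] using this
  have hpos := he hne.some (φ.relabel (Sum.map id Sum.inl)) (fun a b h => by
    rw [Formula.realize_relabel, Sum.elim_comp_map]
    exact (hφ a).1 h.2.2.1)
  have hneg := he hne.some (φ.relabel (Sum.map id Sum.inr)).not (fun a b h => by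
    rw [Formula.realize_not, Formula.realize_relabel, Sum.elim_comp_map]
    exact fun h' => h.2.2.2 ((hφ b).2 h'))
  rw [Formula.realize_not] at hneg
  refine hneg ?_
  rw [Formula.realize_relabel] at hpos ⊢
  have key := hp.indiscernible K g n (fun i => e (Sum.inr (Sum.inl i)))
    (fun i => e (Sum.inr (Sum.inr i))) (fun i => hreal _)
    (fun i j hij => hmem _ _ fun s a b h => h.1.2 i j hij) (fun i => hreal _)
    (fun i j hij => hmem _ _ fun s a b h => h.2.1.2 i j hij) φ
  have e1 : ∀ h : Fin n → Fin n ⊕ Fin n, e ∘ Sum.map id h =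
      Sum.elim g (fun i => e (Sum.inr (h i))) := by
    intro h
    funext i
    rcases i with i | i <;> rfl
  rw [e1] at hpos ⊢
  exact key.1 hpos

/-- The least counterexample `z` would be definable over `M`, hence come from `M`, where
unboundedness and finite satisfiability of `p` supply a larger element. -/
theorem exists_sat_gt (hN : IsModelZFGC N) (hp : IsOmegaMinimal p) (f : M ↪ₑ[setLang] N)
    {s : Finset (ParamFormula M 1)} (hs : ↑s ⊆ p) {z : N} (hz : z ∈ omegaSet N) :
    ∃ u, Sat f s u ∧ z ∈ₘ u := by
  classical
  by_contra hn
  have hD : Dfn f (fun v : Fin 1 → N => ¬ ∃ u, Sat f s u ∧ v 0 ∈ₘ u) := by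
    refine Unif.not (Unif.ex (Unif.and ?_ (Unif.mem (UTerm.var _) (UTerm.var _))))
    exact Dfn.sat f s none
  obtain ⟨r, hr⟩ := hN.existsUnique_least_omega (D := fun z => ¬ ∃ u, Sat f s u ∧ z ∈ₘ u) hD hz hn
  obtain ⟨m, rfl⟩ := mem_range_of_dfn f (r := r) (by
    refine Unif.congr (P := fun v : Fin 1 → N => v 0 ∈ omegaSet N ∧
      (¬ ∃ u, Sat f s u ∧ v 0 ∈ₘ u) ∧ ∀ q, q ∈ₘ v 0 → ¬ ¬ ∃ u, Sat f s u ∧ q ∈ₘ u) ?_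
      (fun v => (hr _).symm) (fun v => (hr _).symm)
    refine Unif.and (Unif.memOmegaSet (UTerm.var _)) (Unif.and hD (Unif.all (Unif.imp
      (Unif.mem (UTerm.var _) (UTerm.var _)) (Unif.not ?_))))
    exact hD.comp (fun _ => none))
  obtain ⟨hm, hm', -⟩ := (hr (f m)).2 rfl
  obtain ⟨a, ha, hma⟩ := exists_sat_above hp hs (t := {m}) (by
    simpa using (mem_omegaSet_map_iff f m).1 hm)
  refine hm' ⟨f a, ⟨(mem_omegaSet_map_iff f a).2 ha.1, fun φ hφ => ?_⟩,
    (mem_map_iff f m a).2 (hma m (by simp))⟩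
  have := (holds_map_iff f φ ![a]).2 (ha.2 φ hφ)
  rwa [show (fun i => f (![a] i)) = ![f a] from funext fun i => by
    rw [Subsingleton.elim i 0]; rfl] at this

end Types

/-! ### Increasing enumerations of finite families of numbers. -/

section Enumeration

variable {N : Type u} [setLang.Structure N]

/-- The natural numbers of a model of `ZFGC` are linearly ordered by membership. -/
@[reducible] noncomputable def omegaLinearOrder (hN : IsModelZFGC N) : LinearOrder (omegaSet N) where
  le x y := x.1 ∈ₘ y.1 ∨ x = y
  lt x y := x.1 ∈ₘ y.1
  le_refl x := Or.inr rfl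
  le_trans x y z := by
    rintro (h | rfl) (h' | rfl)
    · exact Or.inl (hN.omega_lt_trans z.2 h h')
    · exact Or.inl h
    · exact Or.inl h'
    · exact Or.inr rfl
  lt_iff_le_not_ge x y := by
    constructor
    · refine fun h => ⟨Or.inl h, ?_⟩
      rintro (h' | rfl)
      · exact hN.not_mem_mem _ _ ⟨h, h'⟩
      · exact hN.not_mem_self _ h
    · rintro ⟨h | rfl, h'⟩
      · exact h
      · exact absurd (Or.inr rfl) h'
  le_antisymm x y := by
    rintro (h | rfl) (h' | h')
    · exact absurd ⟨h, h'⟩ (hN.not_mem_mem _ _)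
    · exact h'.symm
    · rfl
    · rfl
  le_total x y := by
    rcases hN.omega_trichotomy x.2 y.2 with h | h | h
    · exact Or.inl (Or.inl h)
    · exact Or.inl (Or.inr (Subtype.ext h))
    · exact Or.inr (Or.inl h)
  toDecidableLE := Classical.decRel _

/-- The increasing enumeration of a finite family of natural numbers. -/
theorem exists_enumeration (hN : IsModelZFGC N) {ι : Type*} [Fintype ι] {e : ι → N}
    (he : ∀ i, e i ∈ omegaSet N) :
    ∃ (k : Fin (Fintype.card ι + 1)) (z : Fin k → N) (σ : ι → Fin k),
      (∀ i j, i < j → z i ∈ₘ z j) ∧ (∀ i, e i = z (σ i)) ∧ ∀ j, ∃ i, z j = e i := by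
  classical
  let _ := omegaLinearOrder hN
  let T : Finset (omegaSet N) := Finset.univ.image (fun i => (⟨e i, he i⟩ : omegaSet N))
  have hT : T.card < Fintype.card ι + 1 := Nat.lt_succ_of_le Finset.card_image_le
  have hmem : ∀ i, (⟨e i, he i⟩ : omegaSet N) ∈ T := fun i =>
    Finset.mem_image_of_mem _ (Finset.mem_univ i)
  let o := T.orderIsoOfFin (k := T.card) rfl
  -- Coincidences may shorten the enumeration. Keeping its length in `Fin (card ι + 1)` leaves only
  -- finitely many patterns of length and position map.
  refine ⟨⟨T.card, hT⟩, fun j => ((o j : omegaSet N) : N), fun i => o.symm ⟨_, hmem i⟩, ?_, ?_, ?_⟩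
  · intro i j hij
    exact (o.lt_iff_lt).2 hij
  · intro i
    simp
  · intro j
    obtain ⟨i, -, hi⟩ := Finset.mem_image.1 (o j).2
    exact ⟨i, (congrArg Subtype.val hi).symm⟩

end Enumeration

/-! ### The dichotomy for definable functions on increasing tuples. -/

section Core

variable {M : Type u} {N : Type v} [setLang.Structure N]

theorem incrSat_snoc {f : M → N} {s : Finset (ParamFormula M 1)} {n : ℕ} {x : Fin n → N} {u : N}
    (hx : IncrSat f s x) (hu : Sat f s u) (h : ∀ i, x i ∈ₘ u) :
    IncrSat f s (Fin.snoc x u : Fin (n + 1) → N) := by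
  constructor
  · intro i
    refine Fin.lastCases ?_ (fun i => ?_) i
    · simpa using hu
    · simpa using hx.1 i
  · intro i j
    refine Fin.lastCases ?_ (fun j => ?_) j
    · refine Fin.lastCases ?_ (fun i => ?_) i
      · intro hi; exact absurd hi (lt_irrefl _)
      · intro _; simpa using h i
    · refine Fin.lastCases ?_ (fun i => ?_) i
      · intro hi; exact absurd hi (not_lt.2 (Fin.le_last _))
      · intro hi; simpa using hx.2 i j (Fin.castSucc_lt_castSucc_iff.1 hi)

theorem incrSat_init {f : M → N} {s : Finset (ParamFormula M 1)} {n : ℕ} {x : Fin (n + 1) → N}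
    (hx : IncrSat f s x) : IncrSat f s (fun i : Fin n => x i.castSucc) :=
  ⟨fun _ => hx.1 _, fun _ _ hij => hx.2 _ _ (Fin.castSucc_lt_castSucc_iff.2 hij)⟩

variable [setLang.Structure M] {p : Set (ParamFormula M 1)}

/-- A definable partial function `P` of `m + 1` variables is, on increasing tuples from a large
definable set, either independent of its last variable, or its value determines the last
variable. -/
theorem reduce_or_determine (hN : IsModelZFGC N) (hp : IsOmegaMinimal p) (f : M ↪ₑ[setLang] N)
    {m : ℕ} {P : (Fin (m + 1) → N) → N → Prop}
    (hP : Dfn f (fun w : Option (Fin (m + 1)) → N => P (fun i => w (some i)) (w none)))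
    (hPf : ∀ y z z', P y z → P y z' → z = z') :
    ∃ s : Finset (ParamFormula M 1), ↑s ⊆ p ∧
      ((∀ (x : Fin m → N) u v c c', IncrSat f s (Fin.snoc x u : Fin (m + 1) → N) →
          IncrSat f s (Fin.snoc x v : Fin (m + 1) → N) → P (Fin.snoc x u) c →
          P (Fin.snoc x v) c' → (∃ c, P (Fin.snoc x u) c ∧ P (Fin.snoc x v) c)) ∨
        ∀ x y c, IncrSat f s x → IncrSat f s y → P x c → P y c →
          x (Fin.last m) = y (Fin.last m)) := by
  classical
  -- `D` compares the values at `(x, u)` and `(x, v)` for `x < u < v`.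
  let D : (Fin (m + 2) → N) → Prop := fun z => ∃ c, P (fun i => z i.castSucc) c ∧
    P (fun i => z (Fin.lastCases (Fin.last (m + 1)) (fun i => i.castSucc.castSucc) i)) c
  have hD : Dfn f D := by
    refine Unif.ex (Unif.and ?_ ?_)
    · exact hP.comp (fun o => o.elim none (fun i => some i.castSucc))
    · exact hP.comp (fun o => o.elim none (fun i : Fin (m + 1) => some (Fin.lastCases
        (motive := fun _ => Fin (m + 2)) (Fin.last (m + 1)) (fun i => i.castSucc.castSucc) i)))
  have hDs : ∀ (x : Fin m → N) u v, D (Fin.snoc (Fin.snoc x u : Fin (m + 1) → N) v) ↔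
      ∃ c, P (Fin.snoc x u) c ∧ P (Fin.snoc x v) c := by
    intro x u v
    have e1 : (fun i : Fin (m + 1) => (Fin.snoc (Fin.snoc x u : Fin (m + 1) → N) v : Fin (m + 2) → N)
        i.castSucc) = Fin.snoc x u := by
      funext i; simp
    have e2 : (fun i : Fin (m + 1) => (Fin.snoc (Fin.snoc x u : Fin (m + 1) → N) v : Fin (m + 2) → N)
        (Fin.lastCases (motive := fun _ => Fin (m + 2)) (Fin.last (m + 1))
          (fun i => i.castSucc.castSucc) i)) = Fin.snoc x v := by
      funext i
      refine Fin.lastCases ?_ (fun i => ?_) i <;> simp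
    simp only [D, e1, e2]
  obtain ⟨s, hs, h | h⟩ := exists_homogeneous hp f hD
  · refine ⟨s, hs, Or.inl fun x u v c c' hu hv hc hc' => ?_⟩
    have hxs : IncrSat f s x := by simpa using incrSat_init hu
    have hus : Sat f s u := by simpa using hu.1 (Fin.last m)
    have hvs : Sat f s v := by simpa using hv.1 (Fin.last m)
    rcases hN.omega_trichotomy hus.1 hvs.1 with huv | rfl | huv
    · refine (hDs x u v).1 (h _ (incrSat_snoc hu hvs fun i => ?_))
      refine Fin.lastCases ?_ (fun i => ?_) i
      · simpa using huv
      · simpa using hv.2 i.castSucc (Fin.last m) (Fin.castSucc_lt_last i)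
    -- Homogeneity says nothing when `u = v`; here the assumption that a value exists is used.
    · exact ⟨c, hc, hc⟩
    · obtain ⟨c, h1, h2⟩ := (hDs x v u).1 (h _ (incrSat_snoc hv hus fun i => by
        refine Fin.lastCases ?_ (fun i => ?_) i
        · simpa using huv
        · simpa using hu.2 i.castSucc (Fin.last m) (Fin.castSucc_lt_last i)))
      exact ⟨c, h2, h1⟩
  · -- `E k σ` compares the values at two tuples interleaved according to `σ`.
    let ι := Fin (m + 1) ⊕ Fin m
    let E : (x : Σ k : Fin (Fintype.card ι + 1), ι → Fin k) → (Fin (x.1 + 1) → N) → Prop :=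
      fun x z => ∃ c, P (fun i => z (x.2 (Sum.inl i)).castSucc) c ∧
        P (fun i => z (Fin.lastCases (Fin.last _) (fun i => (x.2 (Sum.inr i)).castSucc) i)) c
    have hE : ∀ x, Dfn f (E x) := by
      intro x
      refine Unif.ex (Unif.and ?_ ?_)
      · exact hP.comp (fun o => o.elim none (fun i => some (x.2 (Sum.inl i)).castSucc))
      · exact hP.comp (fun o => o.elim none (fun i : Fin (m + 1) => some (Fin.lastCases
          (motive := fun _ => Fin (x.1 + 1)) (Fin.last _)
          (fun i => (x.2 (Sum.inr i)).castSucc) i)))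
    choose t ht ht' using fun x => exists_homogeneous hp f (hE x)
    -- There are finitely many interleaving patterns, so one finite part of `p` decides all of them.
    let S := s ∪ Finset.univ.biUnion t
    have hS : (S : Set (ParamFormula M 1)) ⊆ p := by
      intro φ hφ
      rcases Finset.mem_union.1 (Finset.mem_coe.1 hφ) with hφ | hφ
      · exact hs hφ
      · obtain ⟨x, -, hx⟩ := Finset.mem_biUnion.1 hφ
        exact ht x hx
    have hsS : s ⊆ S := Finset.subset_union_left
    have htS : ∀ x, t x ⊆ S := fun x =>
      (Finset.subset_biUnion_of_mem t (Finset.mem_univ x)).trans Finset.subset_union_right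
    refine ⟨S, hS, Or.inr ?_⟩
    -- Here the last entry of `y` exceeds all other entries of both tuples. By homogeneity the
    -- equality of values survives replacing it by any `u < v` satisfying `S` above those entries.
    -- Then `P` has a common value at the two modified tuples, which `h` forbids.
    have main : ∀ x y c, IncrSat f S x → IncrSat f S y → P x c → P y c →
        ¬ x (Fin.last m) ∈ₘ y (Fin.last m) := by
      intro x y c hx hy hxc hyc hlt
      let e : ι → N := Sum.elim x (fun i => y i.castSucc)
      have he : ∀ i, Sat f S (e i) := by
        rintro (i | i)
        · exact hx.1 i
        · exact hy.1 _
      have hey : ∀ i, e i ∈ₘ y (Fin.last m) := by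
        rintro (i | i)
        · rcases (Fin.le_last i).lt_or_eq with hi | rfl
          · exact hN.omega_lt_trans (hy.1 _).1 (hx.2 _ _ hi) hlt
          · exact hlt
        · exact hy.2 _ _ (Fin.castSucc_lt_last i)
      obtain ⟨k, z, σ, hz, hσ, hz'⟩ := exists_enumeration hN (fun i => (he i).1)
      have hzS : IncrSat f S z := ⟨fun j => by
        obtain ⟨i, hi⟩ := hz' j
        rw [hi]; exact he i, hz⟩
      have hEs : ∀ u, E ⟨k, σ⟩ (Fin.snoc z u) ↔
          ∃ c, P x c ∧ P (Fin.snoc (fun i : Fin m => y i.castSucc) u) c := by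
        intro u
        have e1 : (fun i => (Fin.snoc z u : Fin (k + 1) → N) (σ (Sum.inl i)).castSucc) = x := by
          funext i; simp [← hσ, e]
        have e2 : (fun i : Fin (m + 1) => (Fin.snoc z u : Fin (k + 1) → N) (Fin.lastCases
            (motive := fun _ => Fin (k + 1)) (Fin.last _)
            (fun i => (σ (Sum.inr i)).castSucc) i)) = Fin.snoc (fun i : Fin m => y i.castSucc) u := by
          funext i
          refine Fin.lastCases ?_ (fun i => ?_) i
          · simp
          · simp [← hσ, e]
        simp only [E, e1, e2]
      have hinit : (Fin.snoc (fun i : Fin m => y i.castSucc) (y (Fin.last m)) : Fin (m + 1) → N)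
          = y := Fin.snoc_init_self y
      have hpos : ∀ a, IncrSat f (t ⟨k, σ⟩) a → E ⟨k, σ⟩ a := by
        refine (ht' ⟨k, σ⟩).resolve_right fun hneg => ?_
        refine hneg (Fin.snoc z (y (Fin.last m))) ((incrSat_snoc hzS (hy.1 _) fun j => ?_).mono
          (htS _)) ((hEs _).2 ⟨c, hxc, by rwa [hinit]⟩)
        obtain ⟨i, hi⟩ := hz' j
        rw [hi]; exact hey i
      obtain ⟨b, hb, hzb⟩ := hN.exists_lt_of_finite (z := z) fun j => (hzS.1 j).1
      obtain ⟨u, hu, hbu⟩ := exists_sat_gt hN hp f hS hb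
      obtain ⟨v, hv, huv⟩ := exists_sat_gt hN hp f hS hu.1
      have hzu : ∀ j, z j ∈ₘ u := fun j => hN.omega_lt_trans hu.1 (hzb j) hbu
      have hzv : ∀ j, z j ∈ₘ v := fun j => hN.omega_lt_trans hv.1 (hzu j) huv
      obtain ⟨c1, h1, h1'⟩ := (hEs u).1 (hpos _ ((incrSat_snoc hzS hu hzu).mono (htS _)))
      obtain ⟨c2, h2, h2'⟩ := (hEs v).1 (hpos _ ((incrSat_snoc hzS hv hzv).mono (htS _)))
      obtain rfl := hPf _ _ _ h1 h2
      have hyu : ∀ i : Fin m, y i.castSucc ∈ₘ u := fun i => by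
        have := hzu (σ (Sum.inr i))
        rwa [← hσ] at this
      refine h _ ((incrSat_snoc (incrSat_snoc (incrSat_init hy) hu hyu) hv fun i => ?_).mono hsS)
        ((hDs _ u v).2 ⟨c1, h1', h2'⟩)
      refine Fin.lastCases ?_ (fun i => ?_) i
      · simpa using huv
      · simpa using hN.omega_lt_trans hv.1 (hyu i) huv
    intro x y c hx hy hxc hyc
    rcases hN.omega_trichotomy (hx.1 (Fin.last m)).1 (hy.1 (Fin.last m)).1 with h | h | h
    · exact absurd h (main x y c hx hy hxc hyc)
    · exact h
    · exact absurd h (main y x c hy hx hyc hxc)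

end Core

/-! ### Definable closure in terms of definable partial functions. -/

section Graphs

variable {M N I : Type*} [setLang.Structure N]

/-- An element that is definable from a tuple and parameters is the value at that tuple of a
definable partial function. -/
theorem exists_graph {f : M → N} {n : ℕ} {a : Fin n → N} {A : Set N} {b : N} (hb : b ∈ dcl A)
    (hA : A ⊆ Set.range f ∪ Set.range a) :
    ∃ P : (Fin n → N) → N → Prop,
      Dfn f (fun w : Option (Fin n) → N => P (fun i => w (some i)) (w none)) ∧
        (∀ y z z', P y z → P y z' → z = z') ∧ P a b := by
  have hg : ∀ x : A, ∃ i : M ⊕ Fin n, Sum.elim f a i = x := by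
    intro x
    rcases hA x.2 with ⟨m, hm⟩ | ⟨j, hj⟩
    · exact ⟨Sum.inl m, hm⟩
    · exact ⟨Sum.inr j, hj⟩
  choose g hg using hg
  obtain ⟨R, hR, hR'⟩ := Dfn.exists_subst (c := f) (e := a) (Unif.rebase hb g hg hg)
  -- `R` has a unique solution at `a` only; demanding uniqueness makes the relation single-valued at
  -- every argument.
  refine ⟨fun y z => R y (fun _ => z) ∧ ∀ z', R y (fun _ => z') → z' = z, ?_,
    fun y z z' h h' => h'.2 z h.1, ?_⟩
  · refine Unif.and ?_ (Unif.all (Unif.imp ?_ (Unif.eq (UTerm.var _) (UTerm.var _))))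
    · exact hR.comp (Sum.elim some (fun _ => none))
    · exact hR.comp (Sum.elim (fun i => some (some i)) (fun _ => none))
  · exact ⟨(hR' fun _ => b).1 rfl, fun z' hz' => (hR' fun _ => z').2 hz'⟩

theorem mem_dcl_of_graph {f : M → N} {n : ℕ} {P : (Fin n → N) → N → Prop}
    (hP : Dfn f (fun w : Option (Fin n) → N => P (fun i => w (some i)) (w none)))
    (hPf : ∀ y z z', P y z → P y z' → z = z') {a : Fin n → N} {A : Set N}
    (hA : Set.range f ∪ Set.range a ⊆ A) {b : N} (hb : P a b) : b ∈ dcl A := by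
  have h1 : Dfn (Sum.elim f a) (fun w : Option (Fin n) → N => P (fun i => w (some i)) (w none)) :=
    hP.rebase Sum.inl (fun _ => rfl) (fun _ => rfl)
  have h2 : Dfn (Sum.elim f a) (fun v : Fin 1 → N => P a (v 0)) :=
    h1.inst (β := Fin 1) (fun o => o.elim (Sum.inr 0) (fun i => Sum.inl (Sum.inr i)))
  refine Dfn.of_dcl (h2.congr (P' := fun v : Fin 1 → N => v 0 = b)
    (Q' := fun v : Fin 1 → N => v 0 = b) ?_ ?_) ?_
  · exact fun v => ⟨fun h => h ▸ hb, fun h => hPf _ _ _ h hb⟩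
  · exact fun v => ⟨fun h => h ▸ hb, fun h => hPf _ _ _ h hb⟩
  · rintro (i | i)
    · exact subset_dcl A (hA (Or.inl ⟨i, rfl⟩))
    · exact subset_dcl A (hA (Or.inr ⟨i, rfl⟩))

theorem exists_finset_mem_dcl {f : M → N} {α : I → N} {b : N}
    (hb : b ∈ dcl (Set.range f ∪ Set.range α)) :
    ∃ J : Finset I, b ∈ dcl (Set.range f ∪ α '' J) := by
  classical
  obtain ⟨k, g, φ, hφ⟩ := Dfn.exists_finite_params hb
  have hg : ∀ i, ∃ J : Finset I, (g i : N) ∈ Set.range f ∪ α '' J := by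
    intro i
    rcases (g i).2 with h | ⟨j, hj⟩
    · exact ⟨∅, Or.inl h⟩
    · exact ⟨{j}, Or.inr ⟨j, by simp, hj⟩⟩
  choose J hJ using hg
  refine ⟨Finset.univ.biUnion J, ?_⟩
  refine Dfn.of_dcl (dfn_iff.2 ⟨φ, hφ⟩) fun i => subset_dcl _ ?_
  refine Set.union_subset_union_right _ (Set.image_mono ?_) (hJ i)
  exact Finset.coe_subset.2 (Finset.subset_biUnion_of_mem J (Finset.mem_univ i))

end Graphs

/-! ### The extension generated by the realizations. -/

section Generated

/-- An elementary extension generated by an increasing family of realizations of `p` of order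
type `I`. -/
theorem exists_generated_extension {M : Type u} [setLang.Structure M] (hM : IsModelZFGC M)
    {p : Set (ParamFormula M 1)} (hp : IsOmegaMinimal p) (I : Type v) [LinearOrder I] :
    ∃ (N : Type (max u v)) (_ : setLang.Structure N) (f : M ↪ₑ[setLang] N) (α : I → N),
      (∀ i, Realizes f p (α i)) ∧ (∀ i j, i < j → α i ∈ₘ α j) ∧
      dcl (Set.range f ∪ Set.range α) = Set.univ := by
  obtain ⟨K, _, f, α, hα, hαlt⟩ := exists_extension_realizing hp I
  have hK := hM.transfer f
  let A := Set.range f ∪ Set.range α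
  let S := hK.hull A
  have hf : ∀ m, f m ∈ S := fun m => subset_dcl A (Or.inl ⟨m, rfl⟩)
  have hαS : ∀ i, α i ∈ S := fun i => subset_dcl A (Or.inr ⟨i, rfl⟩)
  let g : M ↪ₑ[setLang] S :=
    { toFun := fun m => ⟨f m, hf m⟩
      map_formula' := fun n φ x => by
        rw [← S.subtype.map_formula, ← f.map_formula]
        rfl }
  refine ⟨S, inferInstance, g, fun i => ⟨α i, hαS i⟩, fun i φ hφ => ?_, fun i j hij => ?_, ?_⟩
  · have := hα i φ hφ
    unfold Holds at this ⊢
    rw [← S.subtype.map_formula]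
    refine (iff_of_eq (congrArg _ ?_)).1 this
    funext k
    rcases k with k | k
    · rfl
    · rw [Subsingleton.elim k 0]; rfl
  · exact (mem_map_iff S.subtype _ _).1 (hαlt i j hij)
  · refine Set.eq_univ_of_forall fun b => ?_
    obtain ⟨φ, hφ⟩ := dfn_iff.1 (show Dfn (Subtype.val : A → K) (fun v : Fin 1 → K => v 0 = b.1)
      from b.2)
    have hA : ∀ x : A, ∃ y : ↥(Set.range g ∪ Set.range fun i => (⟨α i, hαS i⟩ : S)),
        (y.1 : K) = x.1 := by
      rintro ⟨x, ⟨m, rfl⟩ | ⟨i, rfl⟩⟩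
      · exact ⟨⟨g m, Or.inl ⟨m, rfl⟩⟩, rfl⟩
      · exact ⟨⟨⟨α i, hαS i⟩, Or.inr ⟨i, rfl⟩⟩, rfl⟩
    choose h hh using hA
    -- The formula defining `b` in `K` also defines it in the elementary substructure `S`.
    refine Unif.rebase (dfn_iff.2 ⟨φ, fun v => ?_⟩) (c := fun x : A => (h x).1)
      (d := fun x : A => (h x).1) h (fun _ => rfl) (fun _ => rfl)
    rw [← S.subtype.map_formula]
    refine Iff.trans ?_ ((hφ (fun i => (v i : K))).trans (iff_of_eq (congrArg _ ?_)))
    · exact Subtype.ext_iff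
    · funext k
      rcases k with k | k
      · exact (hh k).symm
      · rfl

end Generated

/-! ### Locating the new natural numbers. -/

section Main

variable {M : Type u} [setLang.Structure M] {N : Type v} [setLang.Structure N]
  {p : Set (ParamFormula M 1)}

theorem mem_range_of_mem_dcl (f : M ↪ₑ[setLang] N) {b : N} (hb : b ∈ dcl (Set.range f)) :
    b ∈ Set.range f := by
  choose g hg using fun x : Set.range f => x.2
  exact mem_range_of_dfn f (Unif.rebase hb g hg hg)

/-- An element generated by an increasing family of realizations of `p` either comes from the base
model or is the value of a definable partial function that determines its last argument. -/
theorem mem_range_or_determines (hN : IsModelZFGC N) (hp : IsOmegaMinimal p)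
    (f : M ↪ₑ[setLang] N) {I : Type w} [LinearOrder I] {α : I → N}
    (hα : ∀ i, Realizes f p (α i)) (hαlt : ∀ i j, i < j → α i ∈ₘ α j) {b : N}
    (hb : b ∈ dcl (Set.range f ∪ Set.range α)) :
    b ∈ Set.range f ∨ ∃ (m : ℕ) (P : (Fin (m + 1) → N) → N → Prop) (j : Fin (m + 1) → I)
      (s : Finset (ParamFormula M 1)),
      Dfn f (fun w : Option (Fin (m + 1)) → N => P (fun i => w (some i)) (w none)) ∧
      (∀ y z z', P y z → P y z' → z = z') ∧ StrictMono j ∧ P (fun i => α (j i)) b ∧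
      IncrSat f s (fun i => α (j i)) ∧
      ∀ x y c, IncrSat f s x → IncrSat f s y → P x c → P y c →
        x (Fin.last m) = y (Fin.last m) := by
  classical
  obtain ⟨J0, hJ0⟩ := exists_finset_mem_dcl hb
  -- The support `J` is chosen with the least possible number of realizations.
  have hex : ∃ n, ∃ J : Finset I, J.card = n ∧ b ∈ dcl (Set.range f ∪ α '' J) :=
    ⟨_, J0, rfl, hJ0⟩
  obtain ⟨J, hJn, hJ⟩ := Nat.find_spec hex
  have hmin : ∀ J' : Finset I, b ∈ dcl (Set.range f ∪ α '' J') → Nat.find hex ≤ J'.card :=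
    fun J' h => Nat.find_min' hex ⟨J', rfl, h⟩
  rcases hn : Nat.find hex with _ | m
  · rw [hn, Finset.card_eq_zero] at hJn
    subst hJn
    exact Or.inl (mem_range_of_mem_dcl f (by simpa using hJ))
  · rw [hn] at hJn hmin
    let j : Fin (m + 1) → I := J.orderEmbOfFin hJn
    have hj : StrictMono j := (J.orderEmbOfFin hJn).strictMono
    have hincr : ∀ s : Finset (ParamFormula M 1), ↑s ⊆ p → IncrSat f s (fun i => α (j i)) :=
      fun s hs => ⟨fun i => sat_of_realizes hp (hα _) hs, fun i k hik => hαlt _ _ (hj hik)⟩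
    have hrange : α '' J = Set.range (fun i => α (j i)) := by
      rw [← Finset.range_orderEmbOfFin J hJn, ← Set.range_comp]
      rfl
    obtain ⟨P, hP, hPf, hPb⟩ := exists_graph (f := f) (a := fun i => α (j i)) hJ (by rw [hrange])
    obtain ⟨s, hs, h | h⟩ := reduce_or_determine hN hp f hP hPf
    · exfalso
      -- On increasing tuples from `s` the value does not depend on the last argument. Quantifying
      -- it away leaves a partial function that produces `b` from `m` realizations, against
      -- minimality.
      let P' : (Fin m → N) → N → Prop := fun x c => ∃ u,
        IncrSat f s (Fin.snoc x u : Fin (m + 1) → N) ∧ P (Fin.snoc x u) c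
      have hsnoc : ∀ w : Option (Option (Fin m)) → N,
          (Fin.snoc (fun i => w (some (some i))) (w none) : Fin (m + 1) → N) =
            fun i => w (Fin.lastCases (motive := fun _ => Option (Option (Fin m))) none
              (fun i => some (some i)) i) := by
        intro w
        funext i
        refine Fin.lastCases ?_ (fun i => ?_) i <;> simp
      have hP' : Dfn f (fun w : Option (Fin m) → N => P' (fun i => w (some i)) (w none)) := by
        refine Unif.ex (Unif.and ?_ ?_)
        · refine (Dfn.incrSat f s (α := Option (Option (Fin m))) (fun i : Fin (m + 1) =>
            Fin.lastCases (motive := fun _ => Option (Option (Fin m))) none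
              (fun i => some (some i)) i)).congr ?_ ?_ <;>
          · intro w
            rw [← hsnoc]
        · refine (hP.comp (β := Option (Option (Fin m))) (fun o => o.elim (some none)
            (fun i : Fin (m + 1) => Fin.lastCases (motive := fun _ => Option (Option (Fin m))) none
              (fun i => some (some i)) i))).congr ?_ ?_ <;>
          · intro w
            rw [hsnoc]
            rfl
      have hP'f : ∀ y z z', P' y z → P' y z' → z = z' := by
        rintro y z z' ⟨u, hu, hz⟩ ⟨u', hu', hz'⟩
        obtain ⟨c, h1, h2⟩ := h y u u' z z' hu hu' hz hz'
        rw [hPf _ _ _ hz h1, hPf _ _ _ hz' h2]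
      have hinit : (Fin.snoc (fun i : Fin m => α (j i.castSucc)) (α (j (Fin.last m))) :
          Fin (m + 1) → N) = fun i => α (j i) := Fin.snoc_init_self (fun i => α (j i))
      have hJ' := mem_dcl_of_graph hP' hP'f (a := fun i : Fin m => α (j i.castSucc))
        (A := Set.range f ∪ α '' (Finset.univ.image (fun i : Fin m => j i.castSucc) : Finset I)) (by
          refine Set.union_subset_union_right _ ?_
          rintro _ ⟨i, rfl⟩
          exact ⟨j i.castSucc, by simp, rfl⟩) (b := b)
        ⟨α (j (Fin.last m)), by rw [hinit]; exact hincr s hs, by rwa [hinit]⟩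
      have := (hmin _ hJ').trans Finset.card_image_le
      simp at this
    · exact Or.inr ⟨m, P, j, s, hP, hPf, hj, hPb, hincr s hs, h⟩

/-- The least natural number bounding the values of a definable partial function at the tuples of
numbers up to the argument is a partial Skolem function. -/
theorem exists_bounding_skolemFunction (hN : IsModelZFGC N) {A : Set N} {n : ℕ}
    {P : (Fin n → N) → N → Prop}
    (hP : Dfn (Subtype.val : A → N)
      (fun w : Option (Fin n) → N => P (fun i => w (some i)) (w none)))
    (hPf : ∀ y z z', P y z → P y z' → z = z') :
    ∃ t : (Fin 1 → N) → N, IsSkolemFunction A t ∧ ∀ x ∈ omegaSet N, t ![x] ∈ omegaSet N ∧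
      ∀ y : Fin n → N, (∀ i, y i ∈ₘ x ∨ y i = x) → ∀ z ∈ omegaSet N, P y z → z ∈ₘ t ![x] := by
  -- Equality is allowed because in the application the last argument is `x` itself.
  let D : N → N → Prop := fun x b => ∀ y : Fin n → N, (∀ i, y i ∈ₘ x ∨ y i = x) →
    ∀ z, z ∈ omegaSet N → P y z → z ∈ₘ b
  have hD : Dfn (Subtype.val : A → N) (fun v : Fin 2 → N => D (v 0) (v 1)) := by
    refine Unif.allTuple (Unif.imp (Unif.iAnd fun i => (Unif.mem (UTerm.var _) (UTerm.var _)).or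
      (Unif.eq (UTerm.var _) (UTerm.var _))) (Unif.all (Unif.imp (Unif.memOmegaSet (UTerm.var _)) (Unif.imp ?_
        (Unif.mem (UTerm.var _) (UTerm.var _))))))
    exact hP.comp (fun o => o.elim none (fun i => some (Sum.inr i)))
  have hleast : ∀ x ∈ omegaSet N, ∃ r, ∀ r', (r' ∈ omegaSet N ∧ D x r' ∧
      ∀ q, q ∈ₘ r' → ¬ D x q) ↔ r' = r := by
    intro x hx
    obtain ⟨q, hq⟩ := hN.exists_succ x
    obtain ⟨b, hb, hxb⟩ := hN.exists_bound hP.toId hPf (hN.succ_mem hx hq)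
    refine hN.existsUnique_least_omega (c := (id : N → N)) (D := D x) ?_ hb
      fun y hy => hxb y fun i => (hq _).2 (hy i)
    exact hD.toId.inst (β := Fin 1) ![Sum.inl x, Sum.inr 0]
  obtain ⟨t, ht, ht'⟩ := hN.exists_skolemFunction (A := A) (n := 1)
    (P := fun x r => x 0 ∈ omegaSet N ∧ r ∈ omegaSet N ∧ D (x 0) r ∧ ∀ q, q ∈ₘ r → ¬ D (x 0) q)
    (by
      refine Unif.and (Unif.memOmegaSet (UTerm.var _)) (Unif.and (Unif.memOmegaSet (UTerm.var _))
        (Unif.and ?_ (Unif.all (Unif.imp (Unif.mem (UTerm.var _) (UTerm.var _)) (Unif.not ?_)))))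
      · exact hD.comp ![some 0, none]
      · exact hD.comp ![some (some 0), none])
    (by
      rintro y z z' ⟨hy, hz⟩ ⟨-, hz'⟩
      obtain ⟨r, hr⟩ := hleast _ hy
      rw [(hr z).1 hz, (hr z').1 hz'])
  refine ⟨t, ht, fun x hx => ?_⟩
  obtain ⟨r, hr⟩ := hleast x hx
  have hr' := (hr r).2 rfl
  rw [ht' ![x] r ⟨hx, hr'⟩]
  exact ⟨hr'.1, hr'.2.1⟩

/-- The least bound for the values of `R` at numbers below `f m` is definable over `M`, so it comes
from `ω^M`. If `b` were below `f m`, then `a` would be one of these values, yet a realization of `p`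
lies above all of `ω^M`. -/
theorem not_mem_map_of_determined (hN : IsModelZFGC N) (hp : IsOmegaMinimal p)
    (f : M ↪ₑ[setLang] N) {R : (Fin 1 → N) → N → Prop}
    (hR : Dfn f (fun w : Option (Fin 1) → N => R (fun i => w (some i)) (w none)))
    (hRf : ∀ y z z', R y z → R y z' → z = z') {b a : N} (ha : Realizes f p a)
    (hab : R ![b] a) {m : M} (hm : m ∈ omegaSet M) : ¬ b ∈ₘ f m := by
  intro hbm
  let D : N → Prop := fun r => ∀ y : Fin 1 → N, (∀ i, y i ∈ₘ f m) →
    ∀ z, z ∈ omegaSet N → R y z → z ∈ₘ r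
  have hD : Dfn f (fun v : Fin 1 → N => D (v 0)) := by
    refine Unif.allTuple (Unif.imp (Unif.iAnd fun i => Unif.mem (UTerm.var _) (UTerm.param m))
      (Unif.all (Unif.imp (Unif.memOmegaSet (UTerm.var _)) (Unif.imp ?_
        (Unif.mem (UTerm.var _) (UTerm.var _))))))
    exact hR.comp (fun o => o.elim none (fun i => some (Sum.inr i)))
  have hfm : f m ∈ omegaSet N := (mem_omegaSet_map_iff f m).2 hm
  obtain ⟨c, hc, hc'⟩ := hN.exists_bound hR.toId hRf hfm
  obtain ⟨r, hr⟩ := hN.existsUnique_least_omega (D := D) hD hc hc'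
  obtain ⟨m', rfl⟩ := mem_range_of_dfn f (r := r) (by
    refine Unif.congr (P := fun v : Fin 1 → N => v 0 ∈ omegaSet N ∧ D (v 0) ∧
      ∀ q, q ∈ₘ v 0 → ¬ D q) ?_ (fun v => (hr _).symm) (fun v => (hr _).symm)
    refine Unif.and (Unif.memOmegaSet (UTerm.var _)) (Unif.and hD (Unif.all (Unif.imp
      (Unif.mem (UTerm.var _) (UTerm.var _)) (Unif.not ?_))))
    exact hD.comp (fun _ => none))
  obtain ⟨hm', hDm', -⟩ := (hr (f m')).2 rfl
  have h1 : a ∈ₘ f m' := hDm' ![b] (fun i => by rw [Subsingleton.elim i 0]; exact hbm) a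
    (sat_of_realizes hp ha (s := ∅) (by simp)).1 hab
  have h2 : f m' ∈ₘ a := (holds_paramMemVar f m' a).1
    (ha _ (hp.unbounded m' ((mem_omegaSet_map_iff f m').1 hm')))
  exact hN.not_mem_mem _ _ ⟨h1, h2⟩

/-- In the model generated by an increasing family of realizations, every new natural number lies
above those of the base model and belongs to one of the gaps. -/
theorem new_number (hN : IsModelZFGC N) (hp : IsOmegaMinimal p) (f : M ↪ₑ[setLang] N)
    {I : Type w} [LinearOrder I] {α : I → N} (hα : ∀ i, Realizes f p (α i))
    (hαlt : ∀ i j, i < j → α i ∈ₘ α j) {b : N} (hb : b ∈ dcl (Set.range f ∪ Set.range α))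
    (hbω : b ∈ omegaSet N) (hbf : b ∉ f '' omegaSet M) :
    (∀ m ∈ omegaSet M, f m ∈ₘ b) ∧ ∃ i, b ∈ omegaGap (Set.range f) (α i) := by
  rcases mem_range_or_determines hN hp f hα hαlt hb with
    ⟨m, rfl⟩ | ⟨m, P, j, s, hP, hPf, hj, hPb, hsat, hdet⟩
  · exact absurd ⟨m, (mem_omegaSet_map_iff f m).1 hbω, rfl⟩ hbf
  -- The partial inverse of `P`, recovering the last argument from the value.
  let R : (Fin 1 → N) → N → Prop := fun y a =>
    ∃ x : Fin (m + 1) → N, IncrSat f s x ∧ P x (y 0) ∧ a = x (Fin.last m)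
  have hR : Dfn f (fun w : Option (Fin 1) → N => R (fun i => w (some i)) (w none)) := by
    refine Unif.exTuple (Unif.and ?_ (Unif.and ?_ (Unif.eq (UTerm.var _) (UTerm.var _))))
    · exact Dfn.incrSat f s Sum.inr
    · exact hP.comp (fun o => o.elim (Sum.inl (some 0)) Sum.inr)
  have hRf : ∀ y z z', R y z → R y z' → z = z' := by
    rintro y _ _ ⟨x, hx, hxy, rfl⟩ ⟨x', hx', hxy', rfl⟩
    exact hdet x x' (y 0) hx hx' hxy hxy'
  have hRb : R ![b] (α (j (Fin.last m))) := ⟨_, hsat, hPb, rfl⟩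
  have hω : ∀ i, α i ∈ omegaSet N := fun i =>
    (sat_of_realizes hp (hα i) (s := ∅) (by simp)).1
  have hrebase : ∀ {β : Type} {Q : (β → N) → Prop}, Dfn f Q →
      Dfn (Subtype.val : Set.range f → N) Q :=
    fun h => h.rebase (fun m => ⟨f m, m, rfl⟩) (fun _ => rfl) (fun _ => rfl)
  refine ⟨fun k hk => ?_, j (Fin.last m), ⟨hbω, ?_⟩, ?_⟩
  · rcases hN.omega_trichotomy ((mem_omegaSet_map_iff f k).2 hk) hbω with h | h | h
    · exact h
    · exact absurd ⟨k, hk, h⟩ hbf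
    · exact absurd h (not_mem_map_of_determined hN hp f hR hRf (hα _) hRb hk)
  -- All arguments of `P` are at most the last one, so the bounding function at the last one exceeds
  -- `b`.
  · obtain ⟨t, ht, ht'⟩ := exists_bounding_skolemFunction hN (A := Set.range f) (hrebase hP) hPf
    obtain ⟨h1, h2⟩ := ht' _ (hω (j (Fin.last m)))
    refine ⟨t, ht, h1, h2 _ (fun i => ?_) b hbω hPb⟩
    rcases (Fin.le_last i).lt_or_eq with hi | rfl
    · exact Or.inl (hαlt _ _ (hj hi))
    · exact Or.inr rfl
  -- The Skolem function extending `R` maps `b` to the last argument, which would then be less than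
  -- itself.
  · rintro ⟨-, h⟩
    obtain ⟨t, ht, ht'⟩ := hN.exists_skolemFunction (A := Set.range f) (hrebase hR) hRf
    have := h t ht
    rw [ht' _ _ hRb] at this
    exact hN.not_mem_self _ (this (hω _))

end Main

end GaifmanSet

theorem theorem2p4 {M : Type u} [GaifmanSet.setLang.Structure M]
    (hM : GaifmanSet.IsModelZFGC M)
    (p : Set (GaifmanSet.ParamFormula M 1)) (hp : GaifmanSet.IsOmegaMinimal p)
    (I : Type v) [LinearOrder I] :
    ∃ (N : Type (max u v)) (_ : GaifmanSet.setLang.Structure N)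
      (f : M ↪ₑ[GaifmanSet.setLang] N) (α : I → N),
      GaifmanSet.IsOmegaEndExtension f ∧
      (∀ i, GaifmanSet.Realizes f p (α i)) ∧
      (∀ i j, i < j → GaifmanSet.Mem (α i) (α j)) ∧
      GaifmanSet.skolemHull (Set.range f ∪ Set.range α) = Set.univ ∧
      GaifmanSet.omegaSet N =
        f '' GaifmanSet.omegaSet M ∪ ⋃ i, GaifmanSet.omegaGap (Set.range f) (α i) := by
  obtain ⟨N, hNs, f, α, hα, hαlt, hgen⟩ := GaifmanSet.exists_generated_extension hM hp I
  have hN := hM.transfer f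
  have hdcl : ∀ b : N, b ∈ GaifmanSet.dcl (Set.range f ∪ Set.range α) := fun b => by
    rw [hgen]; exact Set.mem_univ b
  refine ⟨N, hNs, f, α, fun a ha b hb hbf => ?_, hα, hαlt, ?_, ?_⟩
  · exact (GaifmanSet.new_number hN hp f hα hαlt (hdcl b) hb hbf).1 a ha
  · rw [hN.skolemHull_eq_dcl, hgen]
  · ext b
    constructor
    · intro hb
      by_cases hbf : b ∈ f '' GaifmanSet.omegaSet M
      · exact Or.inl hbf
      · exact Or.inr (Set.mem_iUnion.2
          (GaifmanSet.new_number hN hp f hα hαlt (hdcl b) hb hbf).2)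
    · rintro (⟨m, hm, rfl⟩ | hb)
      · exact (GaifmanSet.mem_omegaSet_map_iff f m).2 hm
      · obtain ⟨i, hi⟩ := Set.mem_iUnion.1 hb
        exact hi.1.1
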